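/- **Setting.** Let $\mathbb D$ be a bounded open region in $\mathbb R^k$, possibly with some directions made periodic (an open subset of $\mathbb R^k$ invariant under a discrete group of translations, taken modulo that group and bounded modulo it), of total volume $W=|\mathbb D|$. Assume: 1. The Laplacian $-\Delta_{\mathbb D}$ with the given periodic and otherwise Neumann boundary conditions has compact resolvent and a non-degenerate ground state (the constant); let $E_n>0$ and $\varphi_n$ be its other eigenvalues and corresponding real orthonormal eigenfunctions (continuous on $\mathbb D$). 2. For $s>0$ the series $V_2(y,y';s)=\sum_n (2\sqrt{E_n})^{-1}e^{-s\sqrt{E_n}}\varphi_n(y)\varphi_n(y')$ converges for all $y,y'\in\mathbb D$, and $\int_{\mathbb D}V_2(y,y';s)\,dy=0$ for all $y'\in\mathbb D$. 3. There is a positive decreasing function $g$ on $[0,\infty)$ with $\int_0^\infty x\,g(x)\,dx<\infty$ such that $V_2(y,y';s)\ge -g(s)$ for all $s>0$, and for every $\varepsilon>0$ there is $c>0$ with $V_2(y,y';s)\le c\,g(s)$ for all $s\ge\varepsilon$ (for all $y,y'\in\mathbb D$). The Coulomb potential on the tube $\mathbb R\times\mathbb D$ is, for $z=(x,y)$ and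 $z'=(x',y')$, $V(z,z')=-|x-x'|/(2W)+V_2(y,y';|x-x'|)$. Choose units with unit charge and unit particle density and put $\lambda=1/W$. For integers $n_1,n_2$ with $n_1+n_2\ge 0$ and $\theta\in[0,1)$ let $L_1=(-n_1-\theta)\lambda$, $L_2=(n_2-\theta)\lambda$ and $N=n_1+n_2$. The finite-volume Gibbs measure $\mu^{(\beta,W,\theta)}_{n_1,n_2}$ at inverse temperature $\beta$ is the probability measure with density proportional to $e^{-\beta U}$ with respect to Lebesgue measure on the configurations $\omega=(z_1,\dots,z_N)$, $z_j=(x_j,y_j)$, $L_1<x_1<\dots<x_N<L_2$, $y_j\in\mathbb D$, where $$U(\omega)=\sum_{1\le j<l\le N}V(z_j,z_l)-\sum_{j=1}^N\int_{[L_1,L_2]\times\mathbb D}V(z_j,z)\,dz .$$ The particle-excess function is $K(x;\omega)=(x-L_1)/\lambda-|\{j: x_j\le x\}|$ for $x\in[L_1,L_2]$, and $K(x;\omega)=0$ for other $x$. **Theorem (Tightness bound).** For every $\beta>0$, $W>0$ and every $g$ as in 3 there are constants $C<\infty$ and $A>0$, depending only on $\beta$, $W$ and $g$, such that for every $\mathbb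 D$ of volume $W$ which satisfies 1-3 with this $g$, all integers $n_1,n_2$ with $n_1+n_2\ge0$, all $\theta\in[0,1)$, all $x\in[L_1,L_2]$ and all $\gamma\ge0$, $$\mu^{(\beta,W,\theta)}_{n_1,n_2}\bigl(\{|K(x;\omega)|\ge\gamma\}\bigr)\le C\,e^{-A\gamma^2}.$$ -/

import Mathlib

noncomputable section

namespace Jellium

open MeasureTheory Set Filter Topology

/-- The Euclidean space containing the cross-section. -/
abbrev Space (k : ℕ) : Type := EuclideanSpace ℝ (Fin k)

/-- A bounded cross-section, possibly with periodic boundary conditions in some directions.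
`lift` is the open region obtained by unfolding the periodic directions; it is invariant under the
discrete group of `periods`, and `cell` is a fundamental domain of that group. Without periodic
directions, `periods` is trivial and `cell` is the whole space; the flat torus has `lift = univ`.
On the part of the boundary of `lift` that is present, the condition will be Neumann. -/
structure CrossSection (k : ℕ) where
  lift : Set (Space k)
  periods : AddSubgroup (Space k)
  cell : Set (Space k)
  isOpen_lift : IsOpen lift
  nonempty_lift : lift.Nonempty
  discrete_periods : DiscreteTopology periods
  add_mem_lift : ∀ p ∈ periods, ∀ y ∈ lift, y + p ∈ lift
  measurableSet_cell : MeasurableSet cell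
  isFundamental_cell : IsAddFundamentalDomain periods cell (volume : Measure (Space k))
  isBounded : Bornology.IsBounded (lift ∩ cell)

variable {k : ℕ}

/-- The cross-section `𝔻`, as a set of representatives modulo the periods. -/
def CrossSection.carrier (D : CrossSection k) : Set (Space k) := D.lift ∩ D.cell

/-- The total volume `W` of the cross-section. -/
def CrossSection.width (D : CrossSection k) : ℝ := (volume D.carrier).toReal

/-- `v` is the weak gradient of `f` on the open set `U`. -/
def HasWeakGradient (U : Set (Space k)) (f : Space k → ℝ) (v : Space k → Space k) : Prop :=
  LocallyIntegrableOn f U ∧ LocallyIntegrableOn v U ∧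
    ∀ η : Space k → ℝ, ContDiff ℝ (⊤ : ℕ∞) η → HasCompactSupport η → tsupport η ⊆ U →
      ∀ e : Space k,
        ∫ y in U, f y * fderiv ℝ η y e = - ∫ y in U, η y * inner ℝ (v y) e

/-- `f`, with weak gradient `v`, belongs to the Sobolev space `H¹` of the cross-section
(functions that respect the periodic boundary conditions; the form domain of the Laplacian). -/
def CrossSection.IsH1 (D : CrossSection k) (f : Space k → ℝ) (v : Space k → Space k) : Prop :=
  (∀ p ∈ D.periods, ∀ y ∈ D.lift, f (y + p) = f y) ∧
    HasWeakGradient D.lift f v ∧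
    MemLp f 2 (volume.restrict D.carrier) ∧ MemLp v 2 (volume.restrict D.carrier)

/-- `φ` satisfies `-Δ φ = μ φ`, for the Laplacian of the cross-section with the given periodic
and with Neumann boundary conditions, i.e. the operator of the Dirichlet form on `H¹`. -/
def CrossSection.IsEigenfunction (D : CrossSection k) (μ : ℝ) (φ : Space k → ℝ) : Prop :=
  ∃ v, D.IsH1 φ v ∧ ∀ ψ w, D.IsH1 ψ w →
    ∫ y in D.carrier, inner ℝ (v y) (w y) = μ * ∫ y in D.carrier, φ y * ψ y

/-- The Laplacian of the cross-section has compact resolvent and a non-degenerate ground state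
(the constant), and `E`, `φ` enumerate its other eigenvalues and a complete orthonormal system of
eigenfunctions: the eigenvalues `E n` are positive and accumulate at infinity only, and together
with the constant the `φ n` are an orthonormal basis of `L²`. -/
structure CrossSection.IsEigenbasis (D : CrossSection k) {ι : Type}
    (E : ι → ℝ) (φ : ι → Space k → ℝ) : Prop where
  pos : ∀ n, 0 < E n
  tendsto : Tendsto E cofinite atTop
  eigenfunction : ∀ n, D.IsEigenfunction (E n) (φ n)
  continuousOn : ∀ n, ContinuousOn (φ n) D.lift
  norm_eq_one : ∀ n, ∫ y in D.carrier, φ n y ^ 2 = 1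
  orthogonal : ∀ m n, m ≠ n → ∫ y in D.carrier, φ m y * φ n y = 0
  mean_zero : ∀ n, ∫ y in D.carrier, φ n y = 0
  complete : ∀ f : Space k → ℝ, MemLp f 2 (volume.restrict D.carrier) →
    ∫ y in D.carrier, f y = 0 → (∀ n, ∫ y in D.carrier, f y * φ n y = 0) →
    f =ᵐ[volume.restrict D.carrier] 0

/-- The term with index `n` of the short-range part of the Coulomb potential. -/
def shortRangeTerm {ι : Type} (E : ι → ℝ) (φ : ι → Space k → ℝ) (y y' : Space k) (s : ℝ)
    (n : ι) : ℝ :=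
  (2 * √(E n))⁻¹ * Real.exp (-(s * √(E n))) * (φ n y * φ n y')

/-- The short-range part `V₂(y, y'; s)` of the Coulomb potential, at longitudinal distance `s`. -/
def shortRange {ι : Type} (E : ι → ℝ) (φ : ι → Space k → ℝ) (y y' : Space k) (s : ℝ) : ℝ :=
  ∑' n, shortRangeTerm E φ y y' s n

/-- A positive decreasing function on `[0, ∞)` with `∫ x g(x) dx < ∞`. -/
structure IsDecayProfile (g : ℝ → ℝ) : Prop where
  pos : ∀ s, 0 ≤ s → 0 < g s
  antitone : AntitoneOn g (Ici 0)
  integrable : IntegrableOn (fun s => s * g s) (Ioi 0)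

/-- The standing assumptions on the cross-section, with `V₂` controlled by the profile `g`. -/
structure CrossSection.IsAdmissible (D : CrossSection k) {ι : Type}
    (E : ι → ℝ) (φ : ι → Space k → ℝ) (g : ℝ → ℝ) : Prop where
  eigenbasis : D.IsEigenbasis E φ
  summable : ∀ s > 0, ∀ y ∈ D.carrier, ∀ y' ∈ D.carrier, Summable (shortRangeTerm E φ y y' s)
  average_zero : ∀ s > 0, ∀ y' ∈ D.carrier, ∫ y in D.carrier, shortRange E φ y y' s = 0
  lower_bound : ∀ s > 0, ∀ y ∈ D.carrier, ∀ y' ∈ D.carrier, - g s ≤ shortRange E φ y y' s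
  upper_bound : ∀ ε > 0, ∃ c > 0, ∀ s ≥ ε, ∀ y ∈ D.carrier, ∀ y' ∈ D.carrier,
    shortRange E φ y y' s ≤ c * g s

/-- The Coulomb potential of the tube `ℝ × 𝔻`. (At equal first coordinates the series may diverge;
this concerns a null set only.) -/
def CrossSection.coulomb (D : CrossSection k) {ι : Type} (E : ι → ℝ) (φ : ι → Space k → ℝ)
    (z z' : ℝ × Space k) : ℝ :=
  -(|z.1 - z'.1| / (2 * D.width)) + shortRange E φ z.2 z'.2 |z.1 - z'.1|

/-- Energy of `N` particles in `[L₁, L₂] × 𝔻` with a neutralizing uniform background, in units with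
unit charge and unit particle density, without the self-energy of the background. -/
def CrossSection.energy (D : CrossSection k) {ι : Type} (E : ι → ℝ) (φ : ι → Space k → ℝ)
    (L₁ L₂ : ℝ) {N : ℕ} (ω : Fin N → ℝ × Space k) : ℝ :=
  (∑ j : Fin N, ∑ l ∈ Finset.Ioi j, D.coulomb E φ (ω j) (ω l)) -
    ∑ j : Fin N, ∫ z in Icc L₁ L₂ ×ˢ D.carrier, D.coulomb E φ (ω j) z

/-- Configurations of `N` particles in `[L₁, L₂] × 𝔻`, labelled in increasing order along the
tube. -/
def CrossSection.configSpace (D : CrossSection k) (L₁ L₂ : ℝ) (N : ℕ) :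
    Set (Fin N → ℝ × Space k) :=
  {ω | StrictMono (fun j => (ω j).1) ∧ ∀ j, (ω j).1 ∈ Ioo L₁ L₂ ∧ (ω j).2 ∈ D.carrier}

/-- The Boltzmann factor times Lebesgue measure on the configuration space. -/
def CrossSection.gibbsWeight (D : CrossSection k) {ι : Type} (E : ι → ℝ) (φ : ι → Space k → ℝ)
    (β L₁ L₂ : ℝ) (N : ℕ) : Measure (Fin N → ℝ × Space k) :=
  (volume.restrict (D.configSpace L₁ L₂ N)).withDensity
    (fun ω => ENNReal.ofReal (Real.exp (-(β * D.energy E φ L₁ L₂ ω))))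

/-- The Gibbs measure; the total mass of the weight is the partition function. -/
def CrossSection.gibbs (D : CrossSection k) {ι : Type} (E : ι → ℝ) (φ : ι → Space k → ℝ)
    (β L₁ L₂ : ℝ) (N : ℕ) : Measure (Fin N → ℝ × Space k) :=
  (D.gibbsWeight E φ β L₁ L₂ N univ)⁻¹ • D.gibbsWeight E φ β L₁ L₂ N

/-- The length `λ` of a piece of the tube that holds one particle on average (at unit density). -/
def CrossSection.spacing (D : CrossSection k) : ℝ := 1 / D.width

/-- The left end `L₁ = (-n₁ - θ) λ`. -/
def CrossSection.leftEnd (D : CrossSection k) (n₁ : ℤ) (θ : ℝ) : ℝ := (-n₁ - θ) * D.spacing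

/-- The right end `L₂ = (n₂ - θ) λ`. -/
def CrossSection.rightEnd (D : CrossSection k) (n₂ : ℤ) (θ : ℝ) : ℝ := (n₂ - θ) * D.spacing

/-- The Gibbs measure of the neutral system of `n₁ + n₂` particles between `L₁` and `L₂`. -/
def CrossSection.thetaGibbs (D : CrossSection k) {ι : Type} (E : ι → ℝ) (φ : ι → Space k → ℝ)
    (β θ : ℝ) (n₁ n₂ : ℤ) : Measure (Fin (n₁ + n₂).toNat → ℝ × Space k) :=
  D.gibbs E φ β (D.leftEnd n₁ θ) (D.rightEnd n₂ θ) (n₁ + n₂).toNat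

open scoped Classical in
/-- The particle-excess function `K(u; ω)` of a configuration in `[L₁, L₂] × 𝔻`. -/
def CrossSection.excess (D : CrossSection k) (L₁ L₂ : ℝ) {N : ℕ} (u : ℝ)
    (ω : Fin N → ℝ × Space k) : ℝ :=
  if u ∈ Icc L₁ L₂ then
    (u - L₁) / D.spacing - ((Finset.univ.filter fun j => (ω j).1 ≤ u).card : ℝ)
  else 0

end Jellium

end

noncomputable section

namespace Jellium

open MeasureTheory Set Filter Topology
open scoped ENNReal

/-! Along the tube the Coulomb energy is exactly quadratic. With the particles labelled in order,
the pair terms `-|x - x'| / (2W)` and the background complete to half the sum of the squared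
displacements `d` from a lattice of spacing `λ`; the background does not feel `V₂`, whose mean over
the cross-section vanishes (`exists_energy_eq`). The system is therefore a chain pinned to lattice
sites and perturbed by a short-range interaction that is controlled quantitatively only from below,
by `-g`. A particle excess of size `γ` forces a displacement of order `λγ` of one of two particles
whose labels are determined by `x` and `γ`, so Gaussian tails for a single displacement suffice
(`exists_displacement_tail`).

These tails come from a Peierls argument on blocks of labels. A label `p` is good if `|d u| ≤ M +
(λ/8)|u - p|` for all `u`. A strongly displaced label lies in a block bounded by good labels or by
the ends of the system, and a covering argument bounds the length `l` of the block by a small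
multiple of the sum of `d²` over it (`exists_block`). The particles outside the block are held
fixed, and two integrals over those inside are compared.

Upper bound (`lmarginal_indicator_boltzmann_le`): the interaction that touches the block is at least
minus a constant, minus multiples of `l` and of the sum of `|d|` (`sum_pair_le`); good ends keep the
outer particles from crowding into the block. Part of the quadratic energy absorbs the linear term,
and another part gives the factor `exp (-βτ/8)`, where `τ` bounds the sum of `d²` from below.

Lower bound (`le_lmarginal_boltzmann`): the block is moved close to lattice positions, with the
displacements of its ends relaxing to zero inside. The elastic cost is a constant plus a multiple of
`l`. The pair energy has mean zero over the cross-section, so `exp (-t) ≥ 1 - t` removes it, and no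
upper bound on `V₂` enters the constants.

The ratio is at most `C₀ J ^ l exp (-βτ/8)` (`lintegral_indicator_block_le`). Since `τ` may be taken
as `(κ l + γ²) / 2` with `κ` large, `J ^ l` is beaten and the sum over the two ends of the block is
geometric, uniformly in the number of particles. -/

/-! ### Stability of the pair interaction -/

/-- Integral test: for `s ≥ 1` one has `g (c s) ≤ s g (c s)`, so the finite first moment suffices.
The first term of the sum is bounded separately by `g 0`. -/
theorem IsDecayProfile.exists_sum_le {g : ℝ → ℝ} (hg : IsDecayProfile g) {c : ℝ} (hc : 0 < c) :
    ∃ G : ℝ, 0 ≤ G ∧ ∀ n : ℕ, ∑ r ∈ Finset.range n, g (c * ((r : ℝ) + 1)) ≤ G := by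
  have hanti : AntitoneOn (fun s => g (c * s)) (Ici 0) := fun x hx y hy hxy =>
    hg.antitone (mul_nonneg hc.le hx) (mul_nonneg hc.le hy) (mul_le_mul_of_nonneg_left hxy hc.le)
  have hint : IntegrableOn (fun s => (c * s) * g (c * s)) (Ioi 0) := by
    have := (integrableOn_Ioi_comp_mul_left_iff (fun s => s * g s) 0 hc).2 (by simpa using hg.integrable)
    exact this
  refine ⟨g 0 + c⁻¹ * ∫ s in Ioi 0, (c * s) * g (c * s), ?_, ?_⟩
  · have : 0 ≤ ∫ s in Ioi (0:ℝ), (c * s) * g (c * s) :=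
      setIntegral_nonneg measurableSet_Ioi fun s hs =>
        mul_nonneg (mul_nonneg hc.le (le_of_lt hs)) (hg.pos _ (mul_nonneg hc.le (le_of_lt hs))).le
    have := hg.pos 0 le_rfl
    positivity
  · intro n
    have key : ∀ m : ℕ, ∑ r ∈ Finset.range m, g (c * (1 + ((r + 1 : ℕ) : ℝ))) ≤
        c⁻¹ * ∫ s in Ioi 0, (c * s) * g (c * s) := by
      intro m
      have h1 := AntitoneOn.sum_le_integral (x₀ := 1) (a := m) (f := fun s => g (c * s))
        (hanti.mono fun s hs => le_trans zero_le_one hs.1)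
      refine h1.trans ?_
      rw [intervalIntegral.integral_of_le (by simp), ← integral_const_mul]
      have hsub : Ioc (1:ℝ) (1 + m) ⊆ Ioi 0 := fun s hs => lt_trans zero_lt_one hs.1
      calc ∫ s in Ioc (1:ℝ) (1 + m), g (c * s)
          ≤ ∫ s in Ioc (1:ℝ) (1 + m), c⁻¹ * ((c * s) * g (c * s)) := by
            apply setIntegral_mono_on _ ((hint.mono_set hsub).const_mul _) measurableSet_Ioc
            · intro s hs
              have hp := hg.pos (c * s) (mul_nonneg hc.le (hsub hs).le)
              have : c⁻¹ * ((c * s) * g (c * s)) = s * g (c * s) := by field_simp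
              rw [this]
              nlinarith [hs.1]
            · have := (hanti.mono (fun s (hs : s ∈ Icc (1:ℝ) (1 + m)) =>
                le_trans zero_le_one hs.1)).integrableOn_isCompact isCompact_Icc (μ := volume)
              exact this.mono_set Ioc_subset_Icc_self
        _ ≤ ∫ s in Ioi 0, c⁻¹ * ((c * s) * g (c * s)) := by
            apply setIntegral_mono_set (hint.const_mul _)
            · refine (ae_restrict_iff' measurableSet_Ioi).2 (Eventually.of_forall fun s hs => ?_)
              have hs : 0 < s := hs
              have hp := hg.pos (c * s) (mul_nonneg hc.le hs.le)
              simp only [Pi.zero_apply]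
              positivity
            · exact hsub.eventuallyLE
    rcases n with _ | n
    · have := key 0
      have h0 := (hg.pos 0 le_rfl).le
      simp only [Finset.range_zero, Finset.sum_empty] at this ⊢
      positivity
    · rw [Finset.sum_range_succ', add_comm]
      refine add_le_add ?_ (le_of_eq_of_le ?_ (key n))
      · exact hg.antitone (by simp) (by simp; positivity) (by simp; positivity)
      · refine Finset.sum_congr rfl fun r _ => ?_
        congr 2
        push_cast
        ring

/-- The distance of two labels. -/
def labelDist {N : ℕ} (i j : Fin N) : ℕ := (j - i : ℕ) + (i - j : ℕ)

theorem labelDist_comm {N : ℕ} (i j : Fin N) : labelDist i j = labelDist j i := by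
  unfold labelDist; omega

theorem sum_comp_le_sum_range {N : ℕ} (F : ℕ → ℝ) (hF : ∀ n, 0 ≤ F n) (s : Finset (Fin N))
    (e : Fin N → ℕ) (he : ∀ j ∈ s, e j < N) (hinj : InjOn e s) :
    ∑ j ∈ s, F (e j + 1) ≤ ∑ r ∈ Finset.range N, F (r + 1) := by
  rw [← Finset.sum_image (f := fun r => F (r + 1)) hinj]
  refine Finset.sum_le_sum_of_subset_of_nonneg ?_ fun _ _ _ => hF _
  intro r hr
  obtain ⟨j, hj, rfl⟩ := Finset.mem_image.1 hr
  exact Finset.mem_range.2 (he j hj)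

theorem sum_labelDist_le {N : ℕ} (F : ℕ → ℝ) (hF : ∀ n, 0 ≤ F n) (i : Fin N) :
    ∑ j : Fin N, (if i ≠ j then F (labelDist i j) else 0) ≤
      2 * ∑ r ∈ Finset.range N, F (r + 1) := by
  have h : ∀ j : Fin N, (if i ≠ j then F (labelDist i j) else 0) =
      (if i < j then F (labelDist i j) else 0) + (if j < i then F (labelDist i j) else 0) := by
    intro j
    rcases lt_trichotomy i j with h | h | h
    · simp [h, h.ne, h.le]
    · simp [h]
    · simp [h, h.ne', h.le]
  rw [Finset.sum_congr rfl fun j _ => h j, Finset.sum_add_distrib, two_mul]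
  have aux := sum_comp_le_sum_range F hF (N := N)
  rw [← Finset.sum_filter, ← Finset.sum_filter]
  refine add_le_add ?_ ?_
  · refine le_of_eq_of_le (Finset.sum_congr rfl fun j hj => ?_)
      (aux _ (fun j => (j : ℕ) - i - 1) ?_ ?_)
    · have : i < j := (Finset.mem_filter.1 hj).2
      congr 1
      simp only [labelDist]; omega
    · intro j _; omega
    · intro j hj l hl h
      have h1 : i < j := (Finset.mem_filter.1 (Finset.mem_coe.1 hj)).2
      have h2 : i < l := (Finset.mem_filter.1 (Finset.mem_coe.1 hl)).2
      dsimp only at h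
      ext; omega
  · refine le_of_eq_of_le (Finset.sum_congr rfl fun j hj => ?_)
      (aux _ (fun j => (i : ℕ) - j - 1) ?_ ?_)
    · have : j < i := (Finset.mem_filter.1 hj).2
      congr 1
      simp only [labelDist]; omega
    · intro j _; omega
    · intro j hj l hl h
      have h1 : j < i := (Finset.mem_filter.1 (Finset.mem_coe.1 hj)).2
      have h2 : l < i := (Finset.mem_filter.1 (Finset.mem_coe.1 hl)).2
      dsimp only at h
      ext; omega

theorem sum_range_ite_le (N : ℕ) {t : ℝ} (ht : 0 ≤ t) :
    ∑ r ∈ Finset.range N, (if ((r + 1 : ℕ) : ℝ) < t then (1 : ℝ) else 0) ≤ t := by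
  rw [← Finset.sum_filter, Finset.sum_const, nsmul_eq_mul, mul_one]
  refine le_trans ?_ (Nat.floor_le ht)
  norm_cast
  rw [← Finset.card_range ⌊t⌋₊]
  refine Finset.card_le_card fun r hr => ?_
  have := Nat.le_floor (Finset.mem_filter.1 hr).2.le
  exact Finset.mem_range.2 (by omega)

theorem sum_ite_lt_le {N : ℕ} (s : Finset (Fin N)) (e : Fin N → ℕ) (he : ∀ j ∈ s, e j < N)
    (hinj : InjOn e s) {t : ℝ} (ht : 0 ≤ t) :
    ∑ j ∈ s, (if ((e j + 1 : ℕ) : ℝ) < t then (1 : ℝ) else 0) ≤ t :=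
  (sum_comp_le_sum_range (fun n => if (n : ℝ) < t then (1 : ℝ) else 0)
    (fun n => by split_ifs <;> norm_num) s e he hinj).trans (sum_range_ite_le N ht)

/-- A pair that touches `S` is charged to a member in `S`. By symmetry of `F` the two orders of the
labels combine to `i ≠ j`; counting pairs inside `S` twice only enlarges the bound. -/
theorem sum_sum_touching_le {N : ℕ} (S : Finset (Fin N)) (w F : Fin N → Fin N → ℝ)
    (hF : ∀ i j, 0 ≤ F i j) (hsymm : ∀ i j, F i j = F j i)
    (hw : ∀ i j, i < j → w i j ≤ F i j) :
    ∑ i, ∑ j, (if i < j ∧ (i ∈ S ∨ j ∈ S) then w i j else 0) ≤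
      ∑ i ∈ S, ∑ j, (if i ≠ j then F i j else 0) := by
  have h1 : ∑ i, ∑ j, (if i < j ∧ (i ∈ S ∨ j ∈ S) then w i j else 0) ≤
      ∑ i, ∑ j, (if i < j ∧ i ∈ S then F i j else 0) +
        ∑ i, ∑ j, (if i < j ∧ j ∈ S then F i j else 0) := by
    rw [← Finset.sum_add_distrib]
    refine Finset.sum_le_sum fun i _ => ?_
    rw [← Finset.sum_add_distrib]
    refine Finset.sum_le_sum fun j _ => ?_
    have := hF i j
    by_cases hij : i < j
    · have := hw i j hij
      by_cases hi : i ∈ S <;> by_cases hj : j ∈ S <;> simp [hij, hi, hj] <;> linarith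
    · simp [hij]
  refine h1.trans ?_
  rw [Finset.sum_comm (f := fun i j => if i < j ∧ j ∈ S then F i j else 0),
    ← Finset.sum_add_distrib]
  have h2 : ∀ i : Fin N, (∑ j, (if i < j ∧ i ∈ S then F i j else 0) +
      ∑ j, (if j < i ∧ i ∈ S then F j i else 0)) =
      if i ∈ S then ∑ j, (if i ≠ j then F i j else 0) else 0 := by
    intro i
    by_cases hi : i ∈ S
    · simp only [hi, and_true, if_true]
      rw [← Finset.sum_add_distrib]
      refine Finset.sum_congr rfl fun j _ => ?_
      rcases lt_trichotomy i j with h | h | h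
      · simp [h, h.ne, h.not_gt]
      · simp [h]
      · simp [h, h.ne', h.not_gt, hsymm i j]
    · simp [hi]
  rw [Finset.sum_congr rfl fun i _ => h2 i, ← Finset.sum_filter]
  simp

/-- Stability of the pair interaction relative to the displacements from the lattice, for a block
of labels whose surroundings are only moderately displaced. -/
theorem sum_pair_le {N : ℕ} {g : ℝ → ℝ} (hg : IsDecayProfile g) {lam M G : ℝ} (hlam : 0 < lam)
    (hM : 0 ≤ M) {d : ℕ → ℝ} (hmono : StrictMono fun i : ℕ => lam * i + d i) {p q : ℕ} (hqN : q ≤ N + 1)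
    (hpq : p < q) (hp : ∀ u : ℕ, 1 ≤ u → u ≤ p → |d u| ≤ M + lam / 8 * (p - u))
    (hq : ∀ u : ℕ, q ≤ u → u ≤ N → |d u| ≤ M + lam / 8 * (u - q))
    {S : Finset (Fin N)} (hS : ∀ j : Fin N, j ∈ S ↔ p < (j : ℕ) + 1 ∧ (j : ℕ) + 1 < q)
    (hG : ∀ n : ℕ, ∑ r ∈ Finset.range n, g (lam / 2 * ((r : ℝ) + 1)) ≤ G) :
    ∑ i : Fin N, ∑ j : Fin N, (if i < j ∧ (i ∈ S ∨ j ∈ S) then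
        g ((lam * ((j : ℕ) + 1 : ℕ) + d (j + 1)) - (lam * ((i : ℕ) + 1 : ℕ) + d (i + 1))) else 0) ≤
      2 * G * S.card + 16 * g 0 / lam * ∑ i ∈ S, |d (i + 1)| + 2 * g 0 * (8 * M / lam) ^ 2 := by
  have hg0 : 0 < g 0 := hg.pos 0 le_rfl
  -- `I i j` flags a label distance that is small compared with the displacement of `i`. A pair
  -- flagged from neither side keeps at least half its lattice distance, which gives the summable
  -- bound; a flagged pair costs at most `g 0` and is charged to its displaced member.
  set I : Fin N → Fin N → ℝ := fun i j =>
    if (labelDist i j : ℝ) < 4 * |d (i + 1)| / lam then 1 else 0 with hI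
  have hI0 : ∀ i j, 0 ≤ I i j := fun i j => by simp only [hI]; split_ifs <;> norm_num
  have hIsum : ∀ i : Fin N, ∑ j, (if i ≠ j then I i j else 0) ≤ 8 * |d (i + 1)| / lam := by
    intro i
    have h := sum_labelDist_le (fun n : ℕ => if (n : ℝ) < 4 * |d (i + 1)| / lam then (1 : ℝ) else 0)
      (fun n => by split_ifs <;> norm_num) i
    refine h.trans ?_
    have := sum_range_ite_le N (t := 4 * |d (i + 1)| / lam) (by positivity)
    calc _ ≤ 2 * (4 * |d (i + 1)| / lam) := by gcongr
      _ = _ := by ring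
  have hgn : ∀ n : ℕ, 0 < g (lam / 2 * n) := fun n => hg.pos _ (by positivity)
  set F : Fin N → Fin N → ℝ := fun i j =>
    g (lam / 2 * labelDist i j) + g 0 * I i j + g 0 * I j i with hFdef
  have hF0 : ∀ i j, 0 ≤ F i j := fun i j => by
    have := hgn (labelDist i j)
    have := hI0 i j
    have := hI0 j i
    positivity
  have hFs : ∀ i j, F i j = F j i := fun i j => by
    simp only [hFdef, labelDist_comm i j]; ring
  refine (sum_sum_touching_le S _ F hF0 hFs ?_).trans ?_
  · intro i j hij
    have hij' : (i : ℕ) < j := hij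
    have hd : ((labelDist i j : ℕ) : ℝ) = (j : ℝ) - i := by
      have : labelDist i j = (j : ℕ) - i := by simp only [labelDist]; omega
      rw [this, Nat.cast_sub hij'.le]
    have hd' : labelDist j i = labelDist i j := labelDist_comm j i
    have hlt := hmono (show (i : ℕ) + 1 < j + 1 by omega)
    simp only at hlt
    have h0 : g ((lam * ((j : ℕ) + 1 : ℕ) + d (j + 1)) - (lam * ((i : ℕ) + 1 : ℕ) + d (i + 1)))
        ≤ g 0 := hg.antitone (by simp) (by simp only [mem_Ici]; linarith) (by linarith)
    have hpos := hgn (labelDist i j)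
    simp only [hFdef, hI, hd']
    split_ifs with h1 h2 h2
    · linarith
    · linarith
    · linarith
    · rw [hd] at h1 h2 ⊢
      rw [not_lt, div_le_iff₀ hlam] at h1 h2
      have : g ((lam * ((j : ℕ) + 1 : ℕ) + d (j + 1)) - (lam * ((i : ℕ) + 1 : ℕ) + d (i + 1)))
          ≤ g (lam / 2 * ((j : ℝ) - i)) := by
        refine hg.antitone ?_ (by simp only [mem_Ici]; linarith) ?_
        · rw [← hd]; simp only [mem_Ici]; positivity
        · have := neg_abs_le (d (j + 1))
          have := le_abs_self (d (i + 1))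
          push_cast
          linarith
      linarith
  have hsplit : ∑ i ∈ S, ∑ j, (if i ≠ j then F i j else 0) =
      ∑ i ∈ S, ∑ j, (if i ≠ j then g (lam / 2 * labelDist i j) else 0) +
      g 0 * ∑ i ∈ S, ∑ j, (if i ≠ j then I i j else 0) +
      g 0 * ∑ i ∈ S, ∑ j, (if i ≠ j then I j i else 0) := by
    simp only [Finset.mul_sum, ← Finset.sum_add_distrib, hFdef]
    refine Finset.sum_congr rfl fun i _ => Finset.sum_congr rfl fun j _ => ?_
    split_ifs <;> ring
  have hA : ∑ i ∈ S, ∑ j, (if i ≠ j then g (lam / 2 * labelDist i j) else 0) ≤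
      2 * G * S.card := by
    rw [mul_comm (2 * G), ← nsmul_eq_mul]
    refine Finset.sum_le_card_nsmul _ _ _ fun i _ => ?_
    refine (sum_labelDist_le (fun n : ℕ => g (lam / 2 * n)) (fun n => (hgn n).le) i).trans ?_
    have := hG N
    push_cast
    linarith
  have hB : ∑ i ∈ S, ∑ j, (if i ≠ j then I i j else 0) ≤ 8 / lam * ∑ i ∈ S, |d (i + 1)| := by
    rw [Finset.mul_sum]
    refine Finset.sum_le_sum fun i _ => (hIsum i).trans (le_of_eq (by ring))
  have hR : 0 ≤ 8 * M / lam := by positivity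
  set R := 8 * M / lam with hRdef
  have hC : ∑ i ∈ S, ∑ j, (if i ≠ j then I j i else 0) ≤
      8 / lam * ∑ i ∈ S, |d (i + 1)| + 2 * R ^ 2 := by
    set L := Finset.univ.filter fun j : Fin N => (j : ℕ) + 1 ≤ p
    set L' := Finset.univ.filter fun j : Fin N => q ≤ (j : ℕ) + 1
    have hdec : ∀ i ∈ S, ∑ j, (if i ≠ j then I j i else 0) ≤
        ∑ j ∈ S, (if i ≠ j then I j i else 0) + ∑ j ∈ L, (if i ≠ j then I j i else 0) +
          ∑ j ∈ L', (if i ≠ j then I j i else 0) := by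
      intro i _
      simp only [L, L', Finset.sum_filter]
      rw [← Finset.sum_filter_add_sum_filter_not Finset.univ (fun j => j ∈ S), add_assoc]
      refine add_le_add (by simp) ?_
      rw [Finset.sum_filter, ← Finset.sum_add_distrib]
      refine Finset.sum_le_sum fun j _ => ?_
      have := hI0 j i
      have := hS j
      by_cases hjS : j ∈ S
      · simp only [hjS, not_true, if_false]
        split_ifs <;> linarith
      · rcases Nat.lt_or_ge p ((j : ℕ) + 1) with h | h
        · have h' : q ≤ (j : ℕ) + 1 := by
            by_contra hcon
            exact hjS ((hS j).2 ⟨h, by omega⟩)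
          simp only [hjS, h', not_false_eq_true, if_true]
          split_ifs <;> linarith
        · simp only [hjS, h, not_false_eq_true, if_true]
          split_ifs <;> linarith
    refine (Finset.sum_le_sum hdec).trans ?_
    rw [Finset.sum_add_distrib, Finset.sum_add_distrib]
    have h1 : ∑ i ∈ S, ∑ j ∈ S, (if i ≠ j then I j i else 0) ≤ 8 / lam * ∑ i ∈ S, |d (i + 1)| := by
      rw [Finset.sum_comm]
      refine le_trans (Finset.sum_le_sum fun j hj => ?_) hB
      refine (Finset.sum_le_sum_of_subset_of_nonneg (Finset.subset_univ S) ?_).trans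
        (le_of_eq (Finset.sum_congr rfl fun i _ => by simp only [ne_comm]))
      intro i _ _
      have := hI0 j i
      split_ifs <;> linarith
    -- An outer particle at depth `b` beyond the good end has displacement at most `M + λb/8`. If it
    -- flags an inner particle at depth `a`, then `(a + b + 1)λ < 4M + λb/2`, so `a + 1` and `b + 1`
    -- are both below `R`. This leaves at most `R²` pairs on each side.
    have h2 : ∑ i ∈ S, ∑ j ∈ L, (if i ≠ j then I j i else 0) ≤ R * R := by
      calc _ ≤ ∑ i ∈ S, ∑ j ∈ L, (if (((i : ℕ) - p + 1 : ℕ) : ℝ) < R then (1 : ℝ) else 0) *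
            (if ((p - (j : ℕ) - 1 + 1 : ℕ) : ℝ) < R then (1 : ℝ) else 0) := by
            refine Finset.sum_le_sum fun i hi => Finset.sum_le_sum fun j hj => ?_
            have hi := (hS i).1 hi
            have hj : (j : ℕ) + 1 ≤ p := (Finset.mem_filter.1 hj).2
            by_cases h : i ≠ j ∧ (labelDist j i : ℝ) < 4 * |d (j + 1)| / lam
            · have hb := hp _ (by omega) hj
              have h2 := h.2
              have hdist : labelDist j i = ((i : ℕ) - p + 1) + (p - (j : ℕ) - 1 + 1) - 1 := by
                simp only [labelDist]; omega
              obtain ⟨a, ha⟩ : ∃ a, a = (i : ℕ) - p := ⟨_, rfl⟩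
              obtain ⟨b, hb'⟩ : ∃ b, b = p - (j : ℕ) - 1 := ⟨_, rfl⟩
              have hbr : (p : ℝ) - ((j + 1 : ℕ) : ℝ) = b := by
                rw [← Nat.cast_sub hj, hb']; congr 1
              rw [hdist, ← ha, ← hb', lt_div_iff₀ hlam,
                show a + 1 + (b + 1) - 1 = a + b + 1 by omega] at h2
              rw [hbr] at hb
              push_cast at h2
              have hla : 0 ≤ (a : ℝ) * lam := by positivity
              have hlb : 0 ≤ (b : ℝ) * lam := by positivity
              have e1 : (((i : ℕ) - p + 1 : ℕ) : ℝ) < R := by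
                rw [← ha, hRdef, lt_div_iff₀ hlam]; push_cast; nlinarith
              have e2 : ((p - (j : ℕ) - 1 + 1 : ℕ) : ℝ) < R := by
                rw [← hb', hRdef, lt_div_iff₀ hlam]; push_cast; nlinarith
              rw [if_pos e1, if_pos e2]
              simp only [hI]; split_ifs <;> norm_num
            · have : (if i ≠ j then I j i else 0) = 0 := by
                simp only [hI]
                split_ifs with h3 h4
                · exact absurd ⟨h3, h4⟩ h
                · rfl
                · rfl
              rw [this]
              split_ifs <;> norm_num
        _ = (∑ i ∈ S, (if (((i : ℕ) - p + 1 : ℕ) : ℝ) < R then (1 : ℝ) else 0)) *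
            ∑ j ∈ L, (if ((p - (j : ℕ) - 1 + 1 : ℕ) : ℝ) < R then (1 : ℝ) else 0) := by
            rw [Finset.sum_mul_sum]
        _ ≤ R * R := by
            refine mul_le_mul (sum_ite_lt_le S (fun i => (i : ℕ) - p) ?_ ?_ hR)
              (sum_ite_lt_le L (fun j => p - (j : ℕ) - 1) ?_ ?_ hR)
              (Finset.sum_nonneg fun _ _ => by split_ifs <;> norm_num) hR
            · intro i _; omega
            · intro i hi j hj h
              have hi := (hS i).1 hi
              have hj := (hS j).1 hj
              dsimp only at h
              ext; omega
            · intro j hj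
              have hj : (j : ℕ) + 1 ≤ p := (Finset.mem_filter.1 hj).2
              omega
            · intro i hi j hj h
              have hi : (i : ℕ) + 1 ≤ p := (Finset.mem_filter.1 (Finset.mem_coe.1 hi)).2
              have hj : (j : ℕ) + 1 ≤ p := (Finset.mem_filter.1 (Finset.mem_coe.1 hj)).2
              dsimp only at h
              ext; omega
    have h3 : ∑ i ∈ S, ∑ j ∈ L', (if i ≠ j then I j i else 0) ≤ R * R := by
      calc _ ≤ ∑ i ∈ S, ∑ j ∈ L', (if ((q - (i : ℕ) - 2 + 1 : ℕ) : ℝ) < R then (1 : ℝ) else 0) *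
            (if (((j : ℕ) + 1 - q + 1 : ℕ) : ℝ) < R then (1 : ℝ) else 0) := by
            refine Finset.sum_le_sum fun i hi => Finset.sum_le_sum fun j hj => ?_
            have hi := (hS i).1 hi
            have hj : q ≤ (j : ℕ) + 1 := (Finset.mem_filter.1 hj).2
            by_cases h : i ≠ j ∧ (labelDist j i : ℝ) < 4 * |d (j + 1)| / lam
            · have hb := hq _ hj (by omega)
              have h2 := h.2
              have hdist : labelDist j i = (q - (i : ℕ) - 2 + 1) + ((j : ℕ) + 1 - q + 1) - 1 := by
                simp only [labelDist]; omega
              obtain ⟨a, ha⟩ : ∃ a, a = q - (i : ℕ) - 2 := ⟨_, rfl⟩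
              obtain ⟨b, hb'⟩ : ∃ b, b = (j : ℕ) + 1 - q := ⟨_, rfl⟩
              have hbr : ((j + 1 : ℕ) : ℝ) - q = b := by
                rw [← Nat.cast_sub hj, hb']
              rw [hdist, ← ha, ← hb', lt_div_iff₀ hlam,
                show a + 1 + (b + 1) - 1 = a + b + 1 by omega] at h2
              rw [hbr] at hb
              push_cast at h2
              have hla : 0 ≤ (a : ℝ) * lam := by positivity
              have hlb : 0 ≤ (b : ℝ) * lam := by positivity
              have e1 : ((q - (i : ℕ) - 2 + 1 : ℕ) : ℝ) < R := by
                rw [← ha, hRdef, lt_div_iff₀ hlam]; push_cast; nlinarith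
              have e2 : (((j : ℕ) + 1 - q + 1 : ℕ) : ℝ) < R := by
                rw [← hb', hRdef, lt_div_iff₀ hlam]; push_cast; nlinarith
              rw [if_pos e1, if_pos e2]
              simp only [hI]; split_ifs <;> norm_num
            · have : (if i ≠ j then I j i else 0) = 0 := by
                simp only [hI]
                split_ifs with h3 h4
                · exact absurd ⟨h3, h4⟩ h
                · rfl
                · rfl
              rw [this]
              split_ifs <;> norm_num
        _ = (∑ i ∈ S, (if ((q - (i : ℕ) - 2 + 1 : ℕ) : ℝ) < R then (1 : ℝ) else 0)) *
            ∑ j ∈ L', (if (((j : ℕ) + 1 - q + 1 : ℕ) : ℝ) < R then (1 : ℝ) else 0) := by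
            rw [Finset.sum_mul_sum]
        _ ≤ R * R := by
            refine mul_le_mul (sum_ite_lt_le S (fun i => q - (i : ℕ) - 2) ?_ ?_ hR)
              (sum_ite_lt_le L' (fun j => (j : ℕ) + 1 - q) ?_ ?_ hR)
              (Finset.sum_nonneg fun _ _ => by split_ifs <;> norm_num) hR
            · intro i _; omega
            · intro i hi j hj h
              have hi := (hS i).1 hi
              have hj := (hS j).1 hj
              dsimp only at h
              ext; omega
            · intro j hj
              have hj : q ≤ (j : ℕ) + 1 := (Finset.mem_filter.1 hj).2
              omega
            · intro i hi j hj h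
              have hi : q ≤ (i : ℕ) + 1 := (Finset.mem_filter.1 (Finset.mem_coe.1 hi)).2
              have hj : q ≤ (j : ℕ) + 1 := (Finset.mem_filter.1 (Finset.mem_coe.1 hj)).2
              dsimp only at h
              ext; omega
    linarith
  rw [hsplit]
  have h1 := mul_le_mul_of_nonneg_left hB hg0.le
  have h2 := mul_le_mul_of_nonneg_left hC hg0.le
  calc _ ≤ _ := add_le_add (add_le_add hA h1) h2
    _ = _ := by ring

/-! ### Blocks around a displaced label -/

/-- The displacements `d` grow at most linearly around the label `p`. -/
def IsGoodLabel (M ε : ℝ) (d : ℕ → ℝ) (p : ℕ) : Prop :=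
  ∀ u : ℕ, |d u| ≤ M + ε * |(u : ℝ) - p|

theorem card_filter_abs_sub_lt_le (s : Finset ℕ) (u : ℕ) {r : ℝ} (hr : 0 ≤ r) :
    ((s.filter fun i : ℕ => |(u : ℝ) - i| < r).card : ℝ) ≤ 2 * r + 1 := by
  have hsub : (s.filter fun i : ℕ => |(u : ℝ) - i| < r) ⊆ Finset.Icc (u - ⌊r⌋₊) (u + ⌊r⌋₊) := by
    intro i hi
    have h := (Finset.mem_filter.1 hi).2
    rw [abs_lt] at h
    have h1 : (u : ℝ) < i + ⌊r⌋₊ + 1 := by linarith [Nat.lt_floor_add_one r]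
    have h2 : (i : ℝ) < u + ⌊r⌋₊ + 1 := by linarith [Nat.lt_floor_add_one r]
    have h1' : u < i + ⌊r⌋₊ + 1 := by exact_mod_cast h1
    have h2' : i < u + ⌊r⌋₊ + 1 := by exact_mod_cast h2
    rw [Finset.mem_Icc]; omega
  have h1 := Finset.card_le_card hsub
  rw [Nat.card_Icc] at h1
  have h2 : (s.filter fun i : ℕ => |(u : ℝ) - i| < r).card ≤ 2 * ⌊r⌋₊ + 1 := by omega
  have h3 : ((s.filter fun i : ℕ => |(u : ℝ) - i| < r).card : ℝ) ≤ 2 * ⌊r⌋₊ + 1 := by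
    exact_mod_cast h2
  linarith [Nat.floor_le hr]

/-- Around a strongly displaced label there is a block, bounded by good labels or by the ends of
the system, whose length is controlled by its elastic energy. -/
theorem exists_block {N : ℕ} {M ε : ℝ} (hM : 0 < M) (hε : 0 < ε) {d : ℕ → ℝ} (h0 : d 0 = 0)
    (hN : ∀ u, N < u → d u = 0) {u₀ : ℕ} (h1 : 1 ≤ u₀) (h2 : u₀ ≤ N) (hu : M < |d u₀|) :
    ∃ p q : ℕ, p < u₀ ∧ u₀ < q ∧ q ≤ N + 1 ∧ (p = 0 ∨ IsGoodLabel M ε d p) ∧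
      (q = N + 1 ∨ IsGoodLabel M ε d q) ∧
      ((q - p - 1 : ℕ) : ℝ) ≤ ∑ u ∈ Finset.Ioo p q, (2 / (ε * M) + 1 / M ^ 2) * d u ^ 2 := by
  classical
  obtain ⟨p, hp⟩ : ∃ p, p < u₀ ∧ (p = 0 ∨ IsGoodLabel M ε d p) ∧
      ∀ i, p < i → i < u₀ → ¬ IsGoodLabel M ε d i := by
    let P : ℕ → Prop := fun i => i < u₀ ∧ (i = 0 ∨ IsGoodLabel M ε d i)
    have hP : P 0 := ⟨by omega, Or.inl rfl⟩
    have := Nat.findGreatest_spec (P := P) (Nat.zero_le u₀) hP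
    refine ⟨_, this.1, this.2, fun i hi hi' hg => ?_⟩
    exact absurd (Nat.le_findGreatest (P := P) hi'.le ⟨hi', Or.inr hg⟩) (by omega)
  obtain ⟨q, hq⟩ : ∃ q, u₀ < q ∧ q ≤ N + 1 ∧ (q = N + 1 ∨ IsGoodLabel M ε d q) ∧
      ∀ i, u₀ < i → i < q → ¬ IsGoodLabel M ε d i := by
    have hex : ∃ i, u₀ < i ∧ (i = N + 1 ∨ IsGoodLabel M ε d i) := ⟨N + 1, by omega, Or.inl rfl⟩
    refine ⟨Nat.find hex, (Nat.find_spec hex).1, Nat.find_min' hex ⟨by omega, Or.inl rfl⟩,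
      (Nat.find_spec hex).2, fun i hi hi' hg => Nat.find_min hex hi' ⟨hi, Or.inr hg⟩⟩
  obtain ⟨hpu, hpg, hpb⟩ := hp
  obtain ⟨huq, hqN, hqg, hqb⟩ := hq
  refine ⟨p, q, hpu, huq, hqN, hpg, hqg, ?_⟩
  have hbad : ∀ i ∈ Finset.Ioo p q, ¬ IsGoodLabel M ε d i := by
    intro i hi
    rw [Finset.mem_Ioo] at hi
    rcases lt_trichotomy i u₀ with h | h | h
    · exact hpb i hi.1 h
    · subst h
      intro hg
      have := hg i
      simp only [sub_self, abs_zero, mul_zero, add_zero] at this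
      linarith
    · exact hqb i h hi.2
  -- A bad label `s` has a witness `u` with `|d u| > M + ε|u - s|`. The witness lies in the block:
  -- beyond a good end it would be at least as far from `s` as from that end, contradicting goodness
  -- there. Hence the intervals of radius `(|d u| - M) / ε` around the labels `u` of the block cover
  -- it.
  have hcover : Finset.Ioo p q ⊆ (Finset.Ioo p q).biUnion fun u =>
      (Finset.Ioo p q).filter fun i : ℕ => |(u : ℝ) - i| < (|d u| - M) / ε := by
    intro s hs
    have hb := hbad s hs
    unfold IsGoodLabel at hb
    push Not at hb
    obtain ⟨u, hu⟩ := hb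
    have hs' := Finset.mem_Ioo.1 hs
    have hpos : 0 < |d u| := by
      have : 0 ≤ ε * |(u : ℝ) - s| := by positivity
      linarith
    have hu0 : u ≠ 0 := by rintro rfl; simp [h0] at hpos
    have huN : u ≤ N := by
      by_contra h
      rw [hN u (by omega)] at hpos; simp at hpos
    have hmem : u ∈ Finset.Ioo p q := by
      rw [Finset.mem_Ioo]
      by_contra hcon
      rcases Nat.lt_or_ge p u with h | h
      · have hqu : q ≤ u := by omega
        have hg : IsGoodLabel M ε d q := hqg.resolve_left (by omega)
        have := hg u
        have : |(u : ℝ) - q| ≤ |(u : ℝ) - s| := by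
          have e1 : (q : ℝ) ≤ u := by exact_mod_cast hqu
          have e2 : (s : ℝ) ≤ q := by exact_mod_cast hs'.2.le
          rw [abs_of_nonneg (by linarith), abs_of_nonneg (by linarith)]; linarith
        nlinarith
      · have hg : IsGoodLabel M ε d p := hpg.resolve_left (by omega)
        have := hg u
        have : |(u : ℝ) - p| ≤ |(u : ℝ) - s| := by
          have e1 : (u : ℝ) ≤ p := by exact_mod_cast h
          have e2 : (p : ℝ) ≤ s := by exact_mod_cast hs'.1.le
          rw [abs_of_nonpos (by linarith), abs_of_nonpos (by linarith)]; linarith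
        nlinarith
    refine Finset.mem_biUnion.2 ⟨u, hmem, Finset.mem_filter.2 ⟨hs, ?_⟩⟩
    rw [lt_div_iff₀ hε]
    linarith
  have hcard := (Finset.card_le_card hcover).trans Finset.card_biUnion_le
  rw [Nat.card_Ioo] at hcard
  refine le_trans (by exact_mod_cast hcard) (?_ : ((∑ u ∈ Finset.Ioo p q, _ : ℕ) : ℝ) ≤ _)
  push_cast
  refine Finset.sum_le_sum fun u _ => ?_
  -- The interval around `u` is empty unless `|d u| > M`; in that case both its length and the extra
  -- unit from counting integers are bounded by multiples of `(d u)²`.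
  rcases le_or_gt |d u| M with h | h
  · have : (Finset.Ioo p q).filter (fun i : ℕ => |(u : ℝ) - i| < (|d u| - M) / ε) = ∅ := by
      refine Finset.filter_eq_empty_iff.2 fun i _ hi => ?_
      have : (|d u| - M) / ε ≤ 0 := div_nonpos_of_nonpos_of_nonneg (by linarith) hε.le
      have := abs_nonneg ((u : ℝ) - i)
      linarith
    rw [this]
    simp only [Finset.card_empty, Nat.cast_zero]
    positivity
  · have hr : 0 ≤ (|d u| - M) / ε := div_nonneg (by linarith) hε.le
    refine (card_filter_abs_sub_lt_le _ u hr).trans ?_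
    rw [← sq_abs (d u)]
    set t := |d u|
    have e1 : 2 * ((t - M) / ε) ≤ 2 / (ε * M) * t ^ 2 := by
      rw [div_mul_eq_mul_div, le_div_iff₀ (by positivity)]
      have : 2 * ((t - M) / ε) * (ε * M) = 2 * ((t - M) * M) := by field_simp
      rw [this]; nlinarith
    have e2 : 1 ≤ 1 / M ^ 2 * t ^ 2 := by
      rw [div_mul_eq_mul_div, le_div_iff₀ (by positivity)]; nlinarith
    linarith

/-- The order of the particles traps `u` between two labels displaced by at most `M`, so a large
displacement needs a long block. -/
theorem abs_sub_le_mul_of_between {lam M : ℝ} (hlam : 0 < lam) {d : ℕ → ℝ}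
    (hmono : StrictMono fun i : ℕ => lam * i + d i) {p u q : ℕ} (hp : |d p| ≤ M) (hq : |d q| ≤ M)
    (hpu : p < u) (huq : u < q) : |d u| - M ≤ lam * ((q : ℝ) - p) := by
  have h1 := hmono hpu
  have h2 := hmono huq
  simp only at h1 h2
  have e1 : (p : ℝ) ≤ u := by exact_mod_cast hpu.le
  have e2 : (u : ℝ) ≤ q := by exact_mod_cast huq.le
  rw [abs_le] at hp hq
  rcases abs_cases (d u) with ⟨h, _⟩ | ⟨h, _⟩ <;> rw [h] <;> nlinarith

/-! ### Relaxation of a block to the lattice -/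

/-- Soft thresholding: `t` moved towards zero by `r`. -/
def softThreshold (t r : ℝ) : ℝ := t - max (-r) (min t r)

theorem softThreshold_eq_zero {t r : ℝ} (h : |t| ≤ r) : softThreshold t r = 0 := by
  rw [abs_le] at h
  rw [softThreshold, min_eq_left h.2, max_eq_right h.1, sub_self]

theorem softThreshold_zero (t : ℝ) : softThreshold t 0 = t := by
  rw [softThreshold, neg_zero, max_eq_left (min_le_right _ _), sub_zero]

theorem abs_softThreshold_le {t r : ℝ} (hr : 0 ≤ r) : |softThreshold t r| ≤ |t| := by
  rw [softThreshold]
  rcases le_total t r with h1 | h1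
  · rw [min_eq_left h1]
    rcases le_total (-r) t with h2 | h2
    · rw [max_eq_right h2]; simp
    · rw [max_eq_left h2, abs_of_nonpos (by linarith), abs_of_nonpos (by linarith)]; linarith
  · rw [min_eq_right h1, max_eq_right (by linarith), abs_of_nonneg (by linarith),
      abs_of_nonneg (by linarith)]; linarith

theorem abs_softThreshold_sub_le (t r r' : ℝ) :
    |softThreshold t r - softThreshold t r'| ≤ |r - r'| := by
  have h1 : softThreshold t r - softThreshold t r' = max (-r') (min t r') - max (-r) (min t r) := by
    simp only [softThreshold]; ring
  rw [h1, abs_sub_comm r r']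
  refine (abs_max_sub_max_le_max _ _ _ _).trans (max_le (by rw [neg_sub_neg, abs_sub_comm]) ?_)
  refine (abs_min_sub_min_le_max _ _ _ _).trans (max_le (by simp) le_rfl)

/-- Displacements that interpolate between those of the labels `p` and `q`, relaxing to zero away
from these. -/
def relaxed (lam : ℝ) (d : ℕ → ℝ) (p q i : ℕ) : ℝ :=
  softThreshold (d p) (lam / 8 * (i - p)) + softThreshold (d q) (lam / 8 * (q - i))

theorem relaxed_sub_le {lam : ℝ} (hlam : 0 < lam) (d : ℕ → ℝ) (p q i : ℕ) :
    relaxed lam d p q i - lam / 4 ≤ relaxed lam d p q (i + 1) := by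
  have h1 := abs_softThreshold_sub_le (d p) (lam / 8 * (i - p)) (lam / 8 * ((i + 1 : ℕ) - p))
  have h2 := abs_softThreshold_sub_le (d q) (lam / 8 * (q - i)) (lam / 8 * (q - (i + 1 : ℕ)))
  have e1 : lam / 8 * (i - p) - lam / 8 * ((i + 1 : ℕ) - p) = -(lam / 8) := by push_cast; ring
  have e2 : lam / 8 * (q - i) - lam / 8 * (q - (i + 1 : ℕ)) = lam / 8 := by push_cast; ring
  have e3 : |lam / 8| = lam / 8 := abs_of_pos (by positivity)
  rw [e1, abs_neg (lam / 8), e3] at h1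
  rw [e2, e3] at h2
  rw [abs_le] at h1 h2
  simp only [relaxed]
  linarith [h1.2, h2.2]

/-- The hypothesis says that the profile started at `q` has died out on reaching `p`. -/
theorem relaxed_left {lam : ℝ} {d : ℕ → ℝ} {p q : ℕ} (h : |d q| ≤ lam / 8 * (q - p)) :
    relaxed lam d p q p = d p := by
  simp [relaxed, softThreshold_eq_zero h, softThreshold_zero]

theorem relaxed_right {lam : ℝ} {d : ℕ → ℝ} {p q : ℕ} (h : |d p| ≤ lam / 8 * (q - p)) :
    relaxed lam d p q q = d q := by
  simp [relaxed, softThreshold_eq_zero h, softThreshold_zero]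

/-- Inside the block, the displacements `d'` are close to the relaxed ones. -/
structure IsRelaxation (lam : ℝ) (d d' : ℕ → ℝ) (p q : ℕ) : Prop where
  outside : ∀ i, i ≤ p ∨ q ≤ i → d' i = d i
  inside : ∀ i, p < i → i < q → |d' i - relaxed lam d p q i| ≤ lam / 16

/-- Out of the lattice spacing, the two profiles of slope `λ/8` cost at most `λ/4` and the two
tolerances `λ/16` cost `λ/8`. At the ends of the block the relaxed displacement is the actual one,
so the bound also covers the gaps to the neighbours `p` and `q`. -/
theorem IsRelaxation.add_le {lam : ℝ} (hlam : 0 < lam) {d d' : ℕ → ℝ} {p q : ℕ}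
    (h : IsRelaxation lam d d' p q) (hp : |d p| ≤ lam / 8 * (q - p))
    (hq : |d q| ≤ lam / 8 * (q - p)) {i : ℕ} (hpi : p ≤ i) (hiq : i < q) :
    lam * i + d' i + 5 * lam / 8 ≤ lam * (i + 1 : ℕ) + d' (i + 1) := by
  have hclose : ∀ j, p ≤ j → j ≤ q → |d' j - relaxed lam d p q j| ≤ lam / 16 := by
    intro j h1 h2
    rcases h1.eq_or_lt with rfl | h1
    · rw [h.outside _ (Or.inl le_rfl), relaxed_left hq, sub_self, abs_zero]; positivity
    rcases h2.eq_or_lt with rfl | h2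
    · rw [h.outside _ (Or.inr le_rfl), relaxed_right hp, sub_self, abs_zero]; positivity
    exact h.inside j h1 h2
  have h1 := abs_le.1 (hclose i hpi hiq.le)
  have h2 := abs_le.1 (hclose (i + 1) (by omega) hiq)
  have h3 := relaxed_sub_le hlam d p q i
  push_cast
  linarith [h1.2, h2.1]

theorem IsRelaxation.strictMono {lam : ℝ} (hlam : 0 < lam) {d d' : ℕ → ℝ} {p q : ℕ}
    (h : IsRelaxation lam d d' p q) (hmono : StrictMono fun i : ℕ => lam * i + d i)
    (hp : |d p| ≤ lam / 8 * (q - p)) (hq : |d q| ≤ lam / 8 * (q - p)) :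
    StrictMono fun i : ℕ => lam * i + d' i := by
  refine strictMono_nat_of_lt_succ fun i => ?_
  by_cases hi : p ≤ i ∧ i < q
  · have := h.add_le hlam hp hq hi.1 hi.2
    linarith
  · have := hmono (Nat.lt_succ_self i)
    simp only at this
    rw [h.outside i (by omega), h.outside (i + 1) (by omega)]
    exact this

/-- Each relaxed profile is at most `M` and vanishes beyond `R = 8M/λ` labels from its end, so the
cost of the ends does not depend on the length of the block. Only the tolerance `λ/16` is paid for
every label. -/
theorem IsRelaxation.sum_sq_le {N : ℕ} {lam M : ℝ} (hlam : 0 < lam) (hM : 0 ≤ M) {d d' : ℕ → ℝ}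
    {p q : ℕ} (hqN : q ≤ N + 1) (h : IsRelaxation lam d d' p q) (hp : |d p| ≤ M) (hq : |d q| ≤ M)
    {S : Finset (Fin N)} (hS : ∀ j : Fin N, j ∈ S ↔ p < (j : ℕ) + 1 ∧ (j : ℕ) + 1 < q) :
    1 / 2 * ∑ j ∈ S, d' (j + 1) ^ 2 ≤ 24 * M ^ 3 / lam + lam ^ 2 * S.card := by
  set R := 8 * M / lam with hR
  have hR0 : 0 ≤ R := by positivity
  have hterm : ∀ j ∈ S, d' (j + 1) ^ 2 ≤
      3 * M ^ 2 * (if (((j : ℕ) - p + 1 : ℕ) : ℝ) < R then (1 : ℝ) else 0) +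
      3 * M ^ 2 * (if ((q - (j : ℕ) - 2 + 1 : ℕ) : ℝ) < R then (1 : ℝ) else 0) + lam ^ 2 := by
    intro j hj
    have hj := (hS j).1 hj
    have hin := h.inside _ hj.1 hj.2
    have soft : ∀ (t : ℝ) (n : ℕ), |t| ≤ M →
        softThreshold t (lam / 8 * n) ^ 2 ≤ M ^ 2 * (if (n : ℝ) < R then (1 : ℝ) else 0) := by
      intro t n ht
      split_ifs with hn
      · have := (abs_softThreshold_le (t := t) (r := lam / 8 * n) (by positivity)).trans ht
        rw [mul_one, ← sq_abs]
        gcongr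
      · rw [softThreshold_eq_zero]
        · simp
        · rw [hR, not_lt, div_le_iff₀ hlam] at hn
          linarith
    have s1 := soft (d p) ((j : ℕ) - p + 1) hp
    have s2 := soft (d q) (q - (j : ℕ) - 2 + 1) hq
    have e1 : (((j : ℕ) - p + 1 : ℕ) : ℝ) = ((j + 1 : ℕ) : ℝ) - p := by
      rw [← Nat.cast_sub hj.1.le]; congr 1; omega
    have e2 : ((q - (j : ℕ) - 2 + 1 : ℕ) : ℝ) = (q : ℝ) - ((j + 1 : ℕ) : ℝ) := by
      rw [← Nat.cast_sub hj.2.le]; congr 1; omega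
    rw [e1] at s1 ⊢
    rw [e2] at s2 ⊢
    simp only [relaxed] at hin
    set A := softThreshold (d p) (lam / 8 * (((j + 1 : ℕ) : ℝ) - p))
    set B := softThreshold (d q) (lam / 8 * ((q : ℝ) - ((j + 1 : ℕ) : ℝ)))
    have hE : (d' (j + 1) - (A + B)) ^ 2 ≤ (lam / 16) ^ 2 := by
      rw [← sq_abs]; gcongr
    have : d' (j + 1) ^ 2 ≤ 3 * (A ^ 2 + B ^ 2 + (d' (j + 1) - (A + B)) ^ 2) := by
      nlinarith [sq_nonneg (A - B), sq_nonneg (A - (d' (j + 1) - (A + B))),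
        sq_nonneg (B - (d' (j + 1) - (A + B)))]
    nlinarith [sq_nonneg lam]
  have hsum := Finset.sum_le_sum hterm
  rw [Finset.sum_add_distrib, Finset.sum_add_distrib, ← Finset.mul_sum, ← Finset.mul_sum,
    Finset.sum_const, nsmul_eq_mul] at hsum
  have c1 := sum_ite_lt_le S (fun j => (j : ℕ) - p) (fun j _ => by omega) (by
    intro i hi j hj h
    have hi := (hS i).1 hi
    have hj := (hS j).1 hj
    dsimp only at h
    ext; omega) hR0
  have c2 := sum_ite_lt_le S (fun j => q - (j : ℕ) - 2) (fun j _ => by omega) (by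
    intro i hi j hj h
    have hi := (hS i).1 hi
    have hj := (hS j).1 hj
    dsimp only at h
    ext; omega) hR0
  have c1' := mul_le_mul_of_nonneg_left c1 (show 0 ≤ 3 * M ^ 2 by positivity)
  have c2' := mul_le_mul_of_nonneg_left c2 (show 0 ≤ 3 * M ^ 2 by positivity)
  have : 3 * M ^ 2 * R = 24 * M ^ 3 / lam := by rw [hR]; ring
  rw [this] at c1' c2'
  have : 0 ≤ lam ^ 2 * S.card := by positivity
  nlinarith

/-! ### Displacements and the reduced energy -/

section

/-- Positive and negative parts have the same marginal after integration over the coordinate `i`,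
hence the same integral. -/
theorem integral_pi_eq_zero {ι α : Type*} [Fintype ι] [DecidableEq ι] [MeasurableSpace α]
    (ν : ι → Measure α) [∀ i, IsFiniteMeasure (ν i)] (i : ι) {f : (ι → α) → ℝ}
    (hf : Measurable f) {c : ℝ} (hc : ∀ ξ, |f ξ| ≤ c)
    (h : ∀ ξ, ∫ z, f (Function.update ξ i z) ∂ν i = 0) : ∫ ξ, f ξ ∂Measure.pi ν = 0 := by
  have hint : Integrable f (Measure.pi ν) :=
    Integrable.of_bound hf.aestronglyMeasurable c (Eventually.of_forall hc)
  rw [integral_eq_lintegral_pos_part_sub_lintegral_neg_part hint, sub_eq_zero]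
  congr 1
  refine lintegral_eq_of_lmarginal_eq (μ := ν) {i} hf.ennreal_ofReal hf.neg.ennreal_ofReal ?_
  rw [lmarginal_singleton, lmarginal_singleton]
  funext ξ
  have hm : Measurable fun z => f (Function.update ξ i z) := hf.comp (measurable_update ξ)
  have hi : Integrable (fun z => f (Function.update ξ i z)) (ν i) :=
    Integrable.of_bound hm.aestronglyMeasurable c (Eventually.of_forall fun z => hc _)
  have h0 := h ξ
  rw [integral_eq_lintegral_pos_part_sub_lintegral_neg_part hi, sub_eq_zero] at h0
  refine (ENNReal.toReal_eq_toReal_iff' ?_ ?_).1 h0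
  · exact hi.lintegral_lt_top.ne
  · exact hi.neg.lintegral_lt_top.ne

theorem ofReal_integral_le_lintegral {α : Type*} [MeasurableSpace α] {μ : Measure α} {f : α → ℝ}
    (hf : Integrable f μ) : ENNReal.ofReal (∫ x, f x ∂μ) ≤ ∫⁻ x, ENNReal.ofReal (f x) ∂μ := by
  rw [integral_eq_lintegral_pos_part_sub_lintegral_neg_part hf]
  refine (ENNReal.ofReal_le_ofReal (sub_le_self _ ENNReal.toReal_nonneg)).trans ?_
  exact ENNReal.ofReal_toReal_le

variable {Y : Type*}

/-- Displacements of the particles from the sites `a + lam (j + 1/2)`, with the labels shifted by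
one and continued by zero. -/
def displacement (a lam : ℝ) {N : ℕ} (ω : Fin N → ℝ × Y) : ℕ → ℝ
  | 0 => 0
  | j + 1 => if h : j < N then (ω ⟨j, h⟩).1 - (a + lam * (j + 1 / 2)) else 0

/-- Configurations whose first coordinates are increasing in the interval from `a` to `b`. -/
def orderedConfigs (Y : Type*) (a b : ℝ) (N : ℕ) : Set (Fin N → ℝ × Y) :=
  {ω | StrictMono (fun j => (ω j).1) ∧ ∀ j, (ω j).1 ∈ Ioo a b}

section Displacement

variable {a lam : ℝ} {N : ℕ}

theorem displacement_zero (ω : Fin N → ℝ × Y) : displacement a lam ω 0 = 0 := rfl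

theorem displacement_succ (ω : Fin N → ℝ × Y) (j : Fin N) :
    displacement a lam ω (j + 1) = (ω j).1 - (a + lam * ((j : ℝ) + 1 / 2)) := by
  simp [displacement]

theorem displacement_of_lt (ω : Fin N → ℝ × Y) {u : ℕ} (hu : N < u) :
    displacement a lam ω u = 0 := by
  obtain _ | u := u
  · rfl
  · simp [displacement, show ¬ u < N by omega]

theorem displacement_congr {ω ω' : Fin N → ℝ × Y} {i : ℕ}
    (h : ∀ j : Fin N, (j : ℕ) + 1 = i → ω j = ω' j) :
    displacement a lam ω i = displacement a lam ω' i := by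
  obtain _ | i := i
  · rfl
  · by_cases hi : i < N
    · simp [displacement, hi, h ⟨i, hi⟩ rfl]
    · simp [displacement, hi]

theorem measurable_displacement [MeasurableSpace Y] (i : ℕ) :
    Measurable fun ω : Fin N → ℝ × Y => displacement a lam ω i := by
  obtain _ | i := i
  · exact measurable_const
  · by_cases hi : i < N
    · simp only [displacement, hi, dif_pos]
      fun_prop
    · simp only [displacement, hi, dif_neg, not_false_eq_true]
      exact measurable_const

/-- Labels `0` and `N + 1` act as phantom particles half a spacing outside the walls, so that the
walls become part of the ordering and the ends of the system can serve as ends of a block. -/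
theorem strictMono_of_mem_orderedConfigs (hlam : 0 < lam) {ω : Fin N → ℝ × Y}
    (h : ω ∈ orderedConfigs Y a (a + lam * N) N) :
    StrictMono fun i : ℕ => lam * i + displacement a lam ω i := by
  refine strictMono_nat_of_lt_succ fun i => ?_
  rcases lt_trichotomy i N with hi | hi | hi
  · rw [displacement_succ ω ⟨i, hi⟩]
    obtain _ | i := i
    · have := (h.2 ⟨0, hi⟩).1
      rw [displacement_zero]
      push_cast
      linarith
    · rw [displacement_succ ω ⟨i, by omega⟩]
      have : (ω ⟨i, by omega⟩).1 < (ω ⟨i + 1, hi⟩).1 := h.1 (Fin.mk_lt_mk.2 (Nat.lt_succ_self i))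
      push_cast
      linarith
  · subst hi
    rw [displacement_of_lt ω (Nat.lt_succ_self i)]
    obtain _ | i := i
    · rw [displacement_zero]; push_cast; linarith
    · rw [displacement_succ ω ⟨i, by omega⟩]
      have := (h.2 ⟨i, by omega⟩).2
      push_cast at this ⊢
      linarith
  · rw [displacement_of_lt ω hi, displacement_of_lt ω (hi.trans (Nat.lt_succ_self i))]
    push_cast
    linarith

theorem mem_orderedConfigs_of_strictMono {ω : Fin N → ℝ × Y}
    (h : StrictMono fun i : ℕ => lam * i + displacement a lam ω i)
    (h1 : -(lam / 2) < displacement a lam ω 1) (h2 : displacement a lam ω N < lam / 2) :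
    ω ∈ orderedConfigs Y a (a + lam * N) N := by
  have key : ∀ j : Fin N, (ω j).1 = a - lam / 2 +
      (lam * ((j + 1 : ℕ) : ℝ) + displacement a lam ω (j + 1)) := by
    intro j; rw [displacement_succ]; push_cast; ring
  refine ⟨fun i j hij => ?_, fun j => ⟨?_, ?_⟩⟩
  · have := h (show (i : ℕ) + 1 < j + 1 by have : (i : ℕ) < j := hij; omega)
    simp only [key] at this ⊢
    linarith
  · have := h.monotone (show 1 ≤ (j : ℕ) + 1 by omega)
    simp only [Nat.cast_one, mul_one] at this
    rw [key]
    linarith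
  · have := h.monotone (show (j : ℕ) + 1 ≤ N by omega)
    rw [key]
    linarith

theorem measurableSet_orderedConfigs [MeasurableSpace Y] (b : ℝ) : MeasurableSet (orderedConfigs Y a b N) := by
  have : orderedConfigs Y a b N = (⋂ i, ⋂ j, {ω | i < j → (ω i).1 < (ω j).1}) ∩
      ⋂ j, {ω | (ω j).1 ∈ Ioo a b} := by
    ext ω
    simp only [orderedConfigs, StrictMono, mem_ofPred_eq, mem_inter_iff, mem_iInter]
  rw [this]
  refine MeasurableSet.inter (MeasurableSet.iInter fun i => MeasurableSet.iInter fun j => ?_)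
    (MeasurableSet.iInter fun j => ?_)
  · by_cases hij : i < j
    · simp only [hij, forall_const]
      exact measurableSet_lt (by fun_prop) (by fun_prop)
    · simp [hij]
  · exact (show Measurable fun ω : Fin N → ℝ × Y => (ω j).1 by fun_prop) measurableSet_Ioo

end Displacement

/-- A symmetric pair potential that depends on the distance in the first coordinate, with lower
bound `-g`, and vanishing mean with respect to `μ`. -/
structure IsPairPotential [MeasurableSpace Y] (μ : Measure Y) (v : Y → Y → ℝ → ℝ) (g : ℝ → ℝ) : Prop where
  measurable : Measurable fun z : Y × Y × ℝ => v z.1 z.2.1 z.2.2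
  symm : ∀ y y' s, v y y' s = v y' y s
  lower_bound : ∀ s > 0, ∀ y y', -g s ≤ v y y' s
  bounded : ∀ ε > 0, ∃ c, ∀ s ≥ ε, ∀ y y', v y y' s ≤ c
  integral_eq_zero : ∀ s > 0, ∀ y', ∫ y, v y y' s ∂μ = 0

/-- The sum of the pair energies over the pairs that satisfy `P`. -/
def pairEnergy (v : Y → Y → ℝ → ℝ) {N : ℕ} (P : Fin N → Fin N → Prop)
    [∀ i j, Decidable (P i j)] (ω : Fin N → ℝ × Y) : ℝ :=
  ∑ i, ∑ j, if i < j ∧ P i j then v (ω i).2 (ω j).2 |(ω i).1 - (ω j).1| else 0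

/-- The energy up to a constant that depends on the size of the system only. -/
def reducedEnergy (a lam : ℝ) (v : Y → Y → ℝ → ℝ) {N : ℕ} (ω : Fin N → ℝ × Y) : ℝ :=
  1 / 2 * ∑ j : Fin N, displacement a lam ω (j + 1) ^ 2 + pairEnergy v (fun _ _ => True) ω

/-- The Boltzmann factor of the reduced energy. -/
def boltzmann (β a lam : ℝ) (v : Y → Y → ℝ → ℝ) (N : ℕ) : (Fin N → ℝ × Y) → ℝ≥0∞ :=
  (orderedConfigs Y a (a + lam * N) N).indicator fun ω =>
    ENNReal.ofReal (Real.exp (-(β * reducedEnergy a lam v ω)))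

/-- The part of the reduced energy that does not involve the labels in `S`. -/
def outerEnergy (a lam : ℝ) (v : Y → Y → ℝ → ℝ) {N : ℕ} (S : Finset (Fin N))
    (ω : Fin N → ℝ × Y) : ℝ :=
  1 / 2 * ∑ j ∈ Sᶜ, displacement a lam ω (j + 1) ^ 2 +
    pairEnergy v (fun i j => ¬ (i ∈ S ∨ j ∈ S)) ω

theorem measurable_pairEnergy [MeasurableSpace Y] {v : Y → Y → ℝ → ℝ}
    (hv : Measurable fun z : Y × Y × ℝ => v z.1 z.2.1 z.2.2) {N : ℕ} (P : Fin N → Fin N → Prop)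
    [∀ i j, Decidable (P i j)] : Measurable (pairEnergy v P) := by
  unfold pairEnergy
  refine Finset.measurable_sum _ fun i _ => Finset.measurable_sum _ fun j _ => ?_
  by_cases h : i < j ∧ P i j
  · simp only [h]
    exact hv.comp (f := fun ω : Fin N → ℝ × Y => ((ω i).2, (ω j).2, |(ω i).1 - (ω j).1|))
      (by fun_prop)
  · simp only [h, if_false]
    exact measurable_const

theorem measurable_boltzmann [MeasurableSpace Y] (β a lam : ℝ) {v : Y → Y → ℝ → ℝ}
    (hv : Measurable fun z : Y × Y × ℝ => v z.1 z.2.1 z.2.2) (N : ℕ) :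
    Measurable (boltzmann β a lam v N) := by
  refine Measurable.indicator ?_ (measurableSet_orderedConfigs _)
  have h1 := measurable_pairEnergy hv (fun _ _ : Fin N => True)
  have h2 : ∀ j : Fin N, Measurable fun ω : Fin N → ℝ × Y => displacement a lam ω (j + 1) :=
    fun j => measurable_displacement _
  unfold reducedEnergy
  fun_prop

theorem reducedEnergy_eq (a lam : ℝ) (v : Y → Y → ℝ → ℝ) {N : ℕ} (S : Finset (Fin N))
    (ω : Fin N → ℝ × Y) :
    reducedEnergy a lam v ω = outerEnergy a lam v S ω +
      (1 / 2 * ∑ j ∈ S, displacement a lam ω (j + 1) ^ 2 +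
        pairEnergy v (fun i j => i ∈ S ∨ j ∈ S) ω) := by
  have h : pairEnergy v (fun _ _ => True) ω = pairEnergy v (fun i j => ¬ (i ∈ S ∨ j ∈ S)) ω +
      pairEnergy v (fun i j => i ∈ S ∨ j ∈ S) ω := by
    simp only [pairEnergy, ← Finset.sum_add_distrib]
    refine Finset.sum_congr rfl fun i _ => Finset.sum_congr rfl fun j _ => ?_
    by_cases h1 : i < j <;> by_cases h2 : (i ∈ S ∨ j ∈ S) <;> simp [h1, h2]
  rw [reducedEnergy, outerEnergy, h, ← Finset.sum_add_sum_compl S]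
  ring

theorem outerEnergy_congr (a lam : ℝ) (v : Y → Y → ℝ → ℝ) {N : ℕ} {S : Finset (Fin N)}
    {ω ω' : Fin N → ℝ × Y} (h : ∀ j ∉ S, ω j = ω' j) :
    outerEnergy a lam v S ω = outerEnergy a lam v S ω' := by
  unfold outerEnergy pairEnergy
  congr 2
  · refine Finset.sum_congr rfl fun j hj => ?_
    rw [displacement_succ, displacement_succ, h j (Finset.mem_compl.1 hj)]
  · funext i
    refine Finset.sum_congr rfl fun j _ => ?_
    by_cases hS : i ∈ S ∨ j ∈ S
    · simp [hS]
    · rw [h i fun hi => hS (Or.inl hi), h j fun hj => hS (Or.inr hj)]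

end

/-! ### Upper bound for the integral over a block -/

section

variable {Y : Type*}

/-- The particles with (shifted) labels strictly between `p` and `q`. -/
def blockLabels (N p q : ℕ) : Finset (Fin N) :=
  Finset.univ.filter fun j => p < (j : ℕ) + 1 ∧ (j : ℕ) + 1 < q

theorem mem_blockLabels {N p q : ℕ} (j : Fin N) :
    j ∈ blockLabels N p q ↔ p < (j : ℕ) + 1 ∧ (j : ℕ) + 1 < q := by
  simp [blockLabels]

theorem sum_blockLabels {N p q : ℕ} (hq : q ≤ N + 1) (f : ℕ → ℝ) :
    ∑ j ∈ blockLabels N p q, f (j + 1) = ∑ u ∈ Finset.Ioo p q, f u := by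
  refine Finset.sum_bij (fun j _ => (j : ℕ) + 1) ?_ ?_ ?_ fun _ _ => rfl
  · intro j hj
    exact Finset.mem_Ioo.2 ((mem_blockLabels j).1 hj)
  · intro i _ j _ h
    ext; omega
  · intro u hu
    rw [Finset.mem_Ioo] at hu
    exact ⟨⟨u - 1, by omega⟩, (mem_blockLabels _).2 (by dsimp only; omega), by dsimp only; omega⟩

theorem card_blockLabels {N p q : ℕ} (hq : q ≤ N + 1) :
    (blockLabels N p q).card = q - p - 1 := by
  have := sum_blockLabels (p := p) hq fun _ => 1
  simp only [Finset.sum_const, nsmul_eq_mul, mul_one, Nat.card_Ioo] at this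
  exact_mod_cast this

theorem displacement_congr_block {N p q : ℕ} {a lam : ℝ} {ω ω' : Fin N → ℝ × Y}
    (h : ∀ j ∉ blockLabels N p q, ω j = ω' j) {i : ℕ} (hi : i ≤ p ∨ q ≤ i) :
    displacement a lam ω i = displacement a lam ω' i :=
  displacement_congr fun j hj => h j fun hS => by
    have := (mem_blockLabels j).1 hS
    omega

section

variable [MeasurableSpace Y] {μ : Measure Y} {v : Y → Y → ℝ → ℝ} {g : ℝ → ℝ}

theorem neg_pairEnergy_le (hv : IsPairPotential μ v g) (hg : IsDecayProfile g) {a lam M G : ℝ}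
    (hlam : 0 < lam) (hM : 0 ≤ M)
    (hG : ∀ n : ℕ, ∑ r ∈ Finset.range n, g (lam / 2 * ((r : ℝ) + 1)) ≤ G)
    {N p q : ℕ} (hpq : p < q) (hqN : q ≤ N + 1) {ω : Fin N → ℝ × Y}
    (hω : ω ∈ orderedConfigs Y a (a + lam * N) N)
    (hp : p = 0 ∨ IsGoodLabel M (lam / 8) (displacement a lam ω) p)
    (hq : q = N + 1 ∨ IsGoodLabel M (lam / 8) (displacement a lam ω) q) :
    -pairEnergy v (fun i j => i ∈ blockLabels N p q ∨ j ∈ blockLabels N p q) ω ≤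
      2 * G * (blockLabels N p q).card +
        16 * g 0 / lam * ∑ j ∈ blockLabels N p q, |displacement a lam ω (j + 1)| +
        2 * g 0 * (8 * M / lam) ^ 2 := by
  have hmono := strictMono_of_mem_orderedConfigs hlam hω
  refine le_trans ?_ (sum_pair_le hg hlam hM hmono hqN hpq ?_ ?_ mem_blockLabels hG)
  · simp only [pairEnergy, ← Finset.sum_neg_distrib]
    refine Finset.sum_le_sum fun i _ => Finset.sum_le_sum fun j _ => ?_
    split_ifs with h
    · have hlt : (ω i).1 < (ω j).1 := hω.1 h.1
      have h1 := hv.lower_bound ((ω j).1 - (ω i).1) (by linarith) (ω i).2 (ω j).2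
      rw [abs_sub_comm, abs_of_pos (by linarith)]
      have e : lam * ((j : ℕ) + 1 : ℕ) + displacement a lam ω (j + 1) -
          (lam * ((i : ℕ) + 1 : ℕ) + displacement a lam ω (i + 1)) = (ω j).1 - (ω i).1 := by
        rw [displacement_succ, displacement_succ]; push_cast; ring
      rw [e]
      linarith
    · simp
  · intro u h1 h2
    have hu := hp.resolve_left (by omega) u
    have e : (u : ℝ) ≤ p := by exact_mod_cast h2
    rwa [abs_of_nonpos (show (u : ℝ) - p ≤ 0 by linarith), neg_sub] at hu
  · intro u h1 h2
    have hu := hq.resolve_left (by omega) u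
    have e : (q : ℝ) ≤ u := by exact_mod_cast h1
    rwa [abs_of_nonneg (show 0 ≤ (u : ℝ) - q by linarith)] at hu

theorem lintegral_gaussian_prod [IsFiniteMeasure μ] {b : ℝ} (hb : 0 < b) {ι : Type*} [Fintype ι]
    (c : ι → ℝ) :
    ∫⁻ ξ : ι → ℝ × Y, ENNReal.ofReal (∏ i, Real.exp (-b * ((ξ i).1 - c i) ^ 2))
        ∂Measure.pi (fun _ => (volume : Measure ℝ).prod μ) =
      ENNReal.ofReal ((μ.real univ * √(Real.pi / b)) ^ Fintype.card ι) := by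
  have hint : ∀ i, Integrable (fun z : ℝ × Y => Real.exp (-b * (z.1 - c i) ^ 2))
      ((volume : Measure ℝ).prod μ) := fun i =>
    ((integrable_exp_neg_mul_sq hb).comp_sub_right (c i)).comp_fst μ
  rw [← ofReal_integral_eq_lintegral_ofReal
    (Integrable.fintype_prod (f := fun i (z : ℝ × Y) => Real.exp (-b * (z.1 - c i) ^ 2)) hint)
    (Eventually.of_forall fun ξ => Finset.prod_nonneg fun _ _ => (Real.exp_pos _).le),
    integral_fintype_prod_eq_prod (f := fun i (z : ℝ × Y) => Real.exp (-b * (z.1 - c i) ^ 2))]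
  congr 1
  rw [← Finset.card_univ, ← Finset.prod_const]
  refine Finset.prod_congr rfl fun i _ => ?_
  rw [integral_fun_fst (f := fun x : ℝ => Real.exp (-b * (x - c i) ^ 2)), smul_eq_mul]
  congr 1
  rw [integral_sub_right_eq_self (fun x : ℝ => Real.exp (-b * x ^ 2)), integral_gaussian]

open Classical in
-- On the event the interaction that touches the block is bounded below by elastic quantities of the
-- block. After the factor for `τ` is split off, a product of Gaussians in the block coordinates
-- remains, while the outer energy depends on `x` only.
theorem lmarginal_indicator_boltzmann_le [IsFiniteMeasure μ] (hv : IsPairPotential μ v g)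
    (hg : IsDecayProfile g) {β a lam M G τ : ℝ} (hβ : 0 < β) (hlam : 0 < lam) (hM : 0 ≤ M)
    (hG : ∀ n : ℕ, ∑ r ∈ Finset.range n, g (lam / 2 * ((r : ℝ) + 1)) ≤ G)
    {N p q : ℕ} (hpq : p < q) (hqN : q ≤ N + 1) {E : Set (Fin N → ℝ × Y)}
    (hE : ∀ ω ∈ E, (p = 0 ∨ IsGoodLabel M (lam / 8) (displacement a lam ω) p) ∧
      (q = N + 1 ∨ IsGoodLabel M (lam / 8) (displacement a lam ω) q) ∧
      τ ≤ ∑ j ∈ blockLabels N p q, displacement a lam ω (j + 1) ^ 2)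
    (x : Fin N → ℝ × Y) :
    (∫⋯∫⁻_(blockLabels N p q), E.indicator (boltzmann β a lam v N)
        ∂(fun _ => (volume : Measure ℝ).prod μ)) x ≤
      ENNReal.ofReal (Real.exp (-(β * outerEnergy a lam v (blockLabels N p q) x)) *
        Real.exp (β * (2 * g 0 * (8 * M / lam) ^ 2) +
          β * (2 * G + (16 * g 0 / lam) ^ 2) * (blockLabels N p q).card - β / 8 * τ) *
        (μ.real univ * √(Real.pi / (β / 8))) ^ (blockLabels N p q).card) := by
  set S := blockLabels N p q with hS
  rw [ENNReal.ofReal_mul (by positivity), lmarginal]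
  have hJ := lintegral_gaussian_prod (μ := μ) (b := β / 8) (by positivity) (ι := S)
    (fun i => a + lam * (((i : Fin N) : ℝ) + 1 / 2))
  rw [Fintype.card_coe] at hJ
  rw [← hJ, ← lintegral_const_mul _ (by fun_prop)]
  refine lintegral_mono fun ξ => ?_
  set ω := Function.updateFinset x S ξ with hω
  by_cases hmem : ω ∈ E ∧ ω ∈ orderedConfigs Y a (a + lam * N) N
  swap
  · have : E.indicator (boltzmann β a lam v N) ω = 0 := by
      by_cases h1 : ω ∈ E
      · rw [indicator_of_mem h1, boltzmann, indicator_of_notMem fun h2 => hmem ⟨h1, h2⟩]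
      · rw [indicator_of_notMem h1]
    rw [this]
    exact zero_le
  obtain ⟨hωE, hωO⟩ := hmem
  rw [indicator_of_mem hωE, boltzmann, indicator_of_mem hωO, ← ENNReal.ofReal_mul (by positivity)]
  refine ENNReal.ofReal_le_ofReal ?_
  obtain ⟨hp, hq, hτ⟩ := hE ω hωE
  have hpair := neg_pairEnergy_le hv hg hlam hM hG hpq hqN hωO hp hq
  rw [← hS] at hpair
  have hprod : ∏ i : S, Real.exp (-(β / 8) * ((ξ i).1 - (a + lam * (((i : Fin N) : ℝ) + 1 / 2))) ^ 2)
      = Real.exp (-(β / 8) * ∑ j ∈ S, displacement a lam ω (j + 1) ^ 2) := by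
    rw [← Real.exp_sum, Finset.mul_sum, ← Finset.sum_coe_sort S]
    congr 1
    refine Finset.sum_congr rfl fun i _ => ?_
    rw [displacement_succ, hω]
    simp [Function.updateFinset]
  rw [hprod, ← Real.exp_add, ← Real.exp_add]
  refine Real.exp_le_exp.2 ?_
  have hout : outerEnergy a lam v S ω = outerEnergy a lam v S x :=
    outerEnergy_congr a lam v fun j hj => by simp [hω, Function.updateFinset, hj]
  rw [reducedEnergy_eq a lam v S, hout]
  set K := 16 * g 0 / lam
  -- Of the elastic coefficient `1/2`, the amount `1/4` absorbs the linear term, `1/8` pays for `τ`,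
  -- and `1/8` remains as the Gaussian weight.
  have hK : K * ∑ j ∈ S, |displacement a lam ω (j + 1)| ≤
      1 / 4 * ∑ j ∈ S, displacement a lam ω (j + 1) ^ 2 + K ^ 2 * S.card := by
    rw [Finset.mul_sum, Finset.mul_sum, mul_comm (K ^ 2), ← nsmul_eq_mul, ← Finset.sum_const,
      ← Finset.sum_add_distrib]
    refine Finset.sum_le_sum fun j _ => ?_
    rw [← sq_abs (displacement a lam ω (j + 1))]
    nlinarith [sq_nonneg (1 / 2 * |displacement a lam ω (j + 1)| - K)]
  have h1 := mul_le_mul_of_nonneg_left hpair hβ.le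
  have h2 := mul_le_mul_of_nonneg_left hK hβ.le
  have h3 := mul_le_mul_of_nonneg_left hτ hβ.le
  nlinarith

end

end

/-! ### Lower bound for the integral over a block -/

section

variable {Y : Type*} [MeasurableSpace Y] {μ : Measure Y} {v : Y → Y → ℝ → ℝ} {g : ℝ → ℝ}

open Classical in
-- Every pair that counts has a member in `S`, and averaging over the cross-section coordinate of
-- that member alone gives zero, whatever the longitudinal law `ρ` is.
theorem integral_pairEnergy_updateFinset_eq_zero [IsFiniteMeasure μ]
    (hm : Measurable fun z : Y × Y × ℝ => v z.1 z.2.1 z.2.2) (hs : ∀ y y' s, v y y' s = v y' y s)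
    {c : ℝ} (hc : ∀ y y' s, |v y y' s| ≤ c) (h0 : ∀ s y', ∫ y, v y y' s ∂μ = 0)
    {N : ℕ} (S : Finset (Fin N)) (x : Fin N → ℝ × Y) (ρ : S → Measure ℝ)
    [∀ i, IsFiniteMeasure (ρ i)] :
    Integrable (fun ξ => pairEnergy v (fun i j => i ∈ S ∨ j ∈ S) (Function.updateFinset x S ξ))
        (Measure.pi fun i => (ρ i).prod μ) ∧
      ∫ ξ, pairEnergy v (fun i j => i ∈ S ∨ j ∈ S) (Function.updateFinset x S ξ)
        ∂(Measure.pi fun i => (ρ i).prod μ) = 0 := by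
  have hmeas : ∀ i j : Fin N, Measurable fun ξ : S → ℝ × Y =>
      v (Function.updateFinset x S ξ i).2 (Function.updateFinset x S ξ j).2
        |(Function.updateFinset x S ξ i).1 - (Function.updateFinset x S ξ j).1| := by
    intro i j
    have hu : Measurable fun ξ : S → ℝ × Y => Function.updateFinset x S ξ := measurable_updateFinset
    exact hm.comp (f := fun ξ : S → ℝ × Y => ((Function.updateFinset x S ξ i).2,
      (Function.updateFinset x S ξ j).2,
      |(Function.updateFinset x S ξ i).1 - (Function.updateFinset x S ξ j).1|)) (by fun_prop)
  have hinner : ∀ (i : S) (z' : ℝ × Y), ∫ z, v z.2 z'.2 |z.1 - z'.1| ∂((ρ i).prod μ) = 0 := by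
    intro i z'
    rw [integral_prod]
    · simp [h0]
    · refine Integrable.of_bound (C := c) (Measurable.aestronglyMeasurable ?_)
        (Eventually.of_forall fun z => hc _ _ _)
      exact hm.comp (f := fun z : ℝ × Y => (z.2, z'.2, |z.1 - z'.1|)) (by fun_prop)
  have hne : ∀ (i : S) (j : Fin N), j ≠ i → ∀ (ξ : S → ℝ × Y) z,
      Function.updateFinset x S (Function.update ξ i z) j = Function.updateFinset x S ξ j := by
    intro i j hij ξ z
    by_cases hj : j ∈ S
    · have : (⟨j, hj⟩ : S) ≠ i := fun h => hij (by rw [← h])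
      simp [Function.updateFinset, hj, Function.update_of_ne this]
    · simp [Function.updateFinset, hj]
  have heq : ∀ (i : S) (ξ : S → ℝ × Y) z,
      Function.updateFinset x S (Function.update ξ i z) i = z := by
    intro i ξ z
    simp [Function.updateFinset]
  have hzero : ∀ i j : Fin N, i < j → (i ∈ S ∨ j ∈ S) → ∫ ξ : S → ℝ × Y,
      v (Function.updateFinset x S ξ i).2 (Function.updateFinset x S ξ j).2
        |(Function.updateFinset x S ξ i).1 - (Function.updateFinset x S ξ j).1|
        ∂(Measure.pi fun i => (ρ i).prod μ) = 0 := by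
    intro i j hij h
    rcases h with h | h
    · refine integral_pi_eq_zero _ ⟨i, h⟩ (hmeas i j) (fun ξ => hc _ _ _) fun ξ => ?_
      have e1 := heq ⟨i, h⟩ ξ
      have e2 := hne ⟨i, h⟩ j hij.ne' ξ
      simp only at e1
      simp only [e1, e2]
      exact hinner ⟨i, h⟩ _
    · refine integral_pi_eq_zero _ ⟨j, h⟩ (hmeas i j) (fun ξ => hc _ _ _) fun ξ => ?_
      have e1 := heq ⟨j, h⟩ ξ
      have e2 := hne ⟨j, h⟩ i hij.ne ξ
      simp only at e1
      simp only [e1, e2]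
      rw [← hinner ⟨j, h⟩ (Function.updateFinset x S ξ i)]
      refine integral_congr_ae (Eventually.of_forall fun z => ?_)
      simp only
      rw [hs, abs_sub_comm]
  have hint : ∀ i j : Fin N, Integrable (fun ξ : S → ℝ × Y => if i < j ∧ (i ∈ S ∨ j ∈ S) then
      v (Function.updateFinset x S ξ i).2 (Function.updateFinset x S ξ j).2
        |(Function.updateFinset x S ξ i).1 - (Function.updateFinset x S ξ j).1| else 0)
        (Measure.pi fun i => (ρ i).prod μ) := by
    intro i j
    by_cases h : i < j ∧ (i ∈ S ∨ j ∈ S)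
    · simp only [h, and_self, if_true]
      exact Integrable.of_bound (C := c) (hmeas i j).aestronglyMeasurable
        (Eventually.of_forall fun ξ => hc _ _ _)
    · simp only [h, if_false]
      exact integrable_zero _ _ _
  constructor
  · exact integrable_finsetSum _ fun i _ => integrable_finsetSum _ fun j _ => hint i j
  · unfold pairEnergy
    rw [integral_finsetSum _ fun i _ => integrable_finsetSum _ fun j _ => hint i j]
    refine Finset.sum_eq_zero fun i _ => ?_
    rw [integral_finsetSum _ fun j _ => hint i j]
    refine Finset.sum_eq_zero fun j _ => ?_
    by_cases h : i < j ∧ (i ∈ S ∨ j ∈ S)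
    · simp only [h, and_self, if_true]
      exact hzero i j h.1 h.2
    · simp only [h, if_false, integral_zero]

/-- A pair potential cut off at short distances. -/
def truncated (v : Y → Y → ℝ → ℝ) (δ : ℝ) (y y' : Y) (s : ℝ) : ℝ := if δ ≤ s then v y y' s else 0

theorem IsPairPotential.measurable_truncated (hv : IsPairPotential μ v g) (δ : ℝ) :
    Measurable fun z : Y × Y × ℝ => truncated v δ z.1 z.2.1 z.2.2 :=
  Measurable.ite (measurableSet_le measurable_const (by fun_prop)) hv.measurable measurable_const

theorem IsPairPotential.exists_abs_truncated_le (hv : IsPairPotential μ v g)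
    (hg : IsDecayProfile g) {δ : ℝ} (hδ : 0 < δ) :
    ∃ c, ∀ y y' s, |truncated v δ y y' s| ≤ c := by
  obtain ⟨c, hc⟩ := hv.bounded δ hδ
  refine ⟨max c (g 0), fun y y' s => ?_⟩
  have h0 := hg.pos 0 le_rfl
  unfold truncated
  split_ifs with h
  · have h1 := hv.lower_bound s (hδ.trans_le h) y y'
    have h2 : g s ≤ g 0 := hg.antitone (by simp) (hδ.le.trans h) (hδ.le.trans h)
    rw [abs_le]
    exact ⟨by linarith [le_max_right c (g 0)], (hc s h y y').trans (le_max_left _ _)⟩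
  · simp [h0.le]

theorem displacement_bounds {Y : Type*} {a lam : ℝ} (hlam : 0 < lam) {N : ℕ} {ω : Fin N → ℝ × Y}
    (hω : ω ∈ orderedConfigs Y a (a + lam * N) N) :
    -(lam / 2) < displacement a lam ω 1 ∧ displacement a lam ω N < lam / 2 := by
  obtain _ | N := N
  · rw [displacement_zero, displacement_of_lt ω zero_lt_one]
    constructor <;> linarith
  · have h0 := (hω.2 0).1
    have h1 := (hω.2 (Fin.last N)).2
    have e0 := displacement_succ (a := a) (lam := lam) ω 0
    have e1 := displacement_succ (a := a) (lam := lam) ω (Fin.last N)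
    simp only [Fin.val_zero, zero_add, Nat.cast_zero, Fin.val_last] at e0 e1
    push_cast at h1
    rw [e0, e1]
    constructor <;> linarith

open Classical in
-- The integral is restricted to near-relaxed positions of the block. These respect the order and
-- stay apart from each other and from the outer particles, their elastic cost is explicit, and the
-- pair energy averages out over the cross-section.
theorem le_lmarginal_boltzmann [IsFiniteMeasure μ] (hv : IsPairPotential μ v g)
    (hg : IsDecayProfile g) {β a lam M : ℝ} (hβ : 0 < β) (hlam : 0 < lam) (hM : 0 ≤ M)
    (hμ : μ.real univ * lam = 1) {N p q : ℕ} (hpq : p < q) (hqN : q ≤ N + 1) {x : Fin N → ℝ × Y}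
    (hx : x ∈ orderedConfigs Y a (a + lam * N) N)
    (hp : |displacement a lam x p| ≤ M) (hq : |displacement a lam x q| ≤ M)
    (hlen : M ≤ lam / 8 * (q - p)) :
    ENNReal.ofReal (Real.exp (-(β * outerEnergy a lam v (blockLabels N p q) x)) *
        Real.exp (-(β * (24 * M ^ 3 / lam + lam ^ 2 * (blockLabels N p q).card))) *
        (1 / 8) ^ (blockLabels N p q).card) ≤
      (∫⋯∫⁻_(blockLabels N p q), boltzmann β a lam v N
        ∂(fun _ => (volume : Measure ℝ).prod μ)) x := by
  set S := blockLabels N p q with hS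
  set d := displacement a lam x with hd
  -- Longitudinal windows of width `λ/8` around the relaxed sites. The cross-section coordinate is
  -- left free, so each window has mass `Wλ/8 = 1/8`.
  set I : S → Set ℝ := fun i =>
    Icc (a + lam * (((i : Fin N) : ℝ) + 1 / 2) + relaxed lam d p q ((i : Fin N) + 1) - lam / 16)
      (a + lam * (((i : Fin N) : ℝ) + 1 / 2) + relaxed lam d p q ((i : Fin N) + 1) + lam / 16)
    with hI
  set G : Set (S → ℝ × Y) := univ.pi fun i => I i ×ˢ univ with hG
  have hGm : MeasurableSet G :=
    MeasurableSet.univ_pi fun i => measurableSet_Icc.prod MeasurableSet.univ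
  have hpi : (Measure.pi fun _ : S => (volume : Measure ℝ).prod μ).restrict G =
      Measure.pi fun i : S => (volume.restrict (I i)).prod μ := by
    rw [hG, Measure.restrict_pi_pi]
    congr 1
    funext i
    rw [← Measure.prod_restrict, Measure.restrict_univ]
  have hrelax : ∀ ξ ∈ G, IsRelaxation lam d
      (displacement a lam (Function.updateFinset x S ξ)) p q := by
    intro ξ hξ
    constructor
    · intro i hi
      refine displacement_congr_block (p := p) (q := q) (fun j hj => ?_) hi
      have : j ∉ S := hj
      simp [Function.updateFinset, this]
    · intro i h1 h2
      obtain ⟨j, rfl⟩ : ∃ j : Fin N, i = j + 1 := ⟨⟨i - 1, by omega⟩, by simp only; omega⟩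
      have hj : j ∈ S := (mem_blockLabels j).2 ⟨h1, h2⟩
      have hmem := (hξ ⟨j, hj⟩ (mem_univ _)).1
      rw [displacement_succ]
      simp only [hI, mem_Icc] at hmem
      simp only [Function.updateFinset, hj, dif_pos]
      rw [abs_le]
      constructor <;> linarith [hmem.1, hmem.2]
  have hp' : |d p| ≤ lam / 8 * (q - p) := hp.trans hlen
  have hq' : |d q| ≤ lam / 8 * (q - p) := hq.trans hlen
  have hmono := strictMono_of_mem_orderedConfigs hlam hx
  have hord : ∀ ξ ∈ G, Function.updateFinset x S ξ ∈ orderedConfigs Y a (a + lam * N) N := by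
    intro ξ hξ
    have hr := hrelax ξ hξ
    refine mem_orderedConfigs_of_strictMono (hr.strictMono hlam hmono hp' hq') ?_ ?_
    · rcases Nat.eq_zero_or_pos p with rfl | h
      · have h1 := hr.add_le hlam hp' hq' le_rfl hpq
        rw [displacement_zero] at h1
        push_cast at h1
        linarith
      · rw [hr.outside 1 (Or.inl h)]
        exact (displacement_bounds hlam hx).1
    · rcases Nat.lt_or_ge N q with h | h
      · have h1 := hr.add_le hlam hp' hq' (show p ≤ N by omega) h
        rw [displacement_of_lt _ (Nat.lt_succ_self N)] at h1
        push_cast at h1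
        linarith
      · rw [hr.outside N (Or.inr h)]
        exact (displacement_bounds hlam hx).2
  -- Touching pairs are at least `5λ/8` apart on `G`, so a cutoff at `λ/2` changes nothing there. It
  -- makes the potential bounded, hence integrable; the bound itself does not enter the estimate.
  have hsep : ∀ ξ ∈ G, pairEnergy v (fun i j => i ∈ S ∨ j ∈ S) (Function.updateFinset x S ξ) =
      pairEnergy (truncated v (lam / 2)) (fun i j => i ∈ S ∨ j ∈ S)
        (Function.updateFinset x S ξ) := by
    intro ξ hξ
    have hr := hrelax ξ hξ
    have hm := (hr.strictMono hlam hmono hp' hq').monotone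
    unfold pairEnergy
    refine Finset.sum_congr rfl fun i _ => Finset.sum_congr rfl fun j _ => ?_
    split_ifs with h
    · rw [truncated, if_pos]
      have hij : (i : ℕ) < j := h.1
      have key : ∀ j : Fin N, (Function.updateFinset x S ξ j).1 = a - lam / 2 +
          (lam * ((j + 1 : ℕ) : ℝ) +
            displacement a lam (Function.updateFinset x S ξ) (j + 1)) := by
        intro j; rw [displacement_succ]; push_cast; ring
      rw [abs_sub_comm]
      refine le_trans ?_ (le_abs_self _)
      rw [key i, key j]
      rcases h.2 with hi | hj
      · have hi := (mem_blockLabels i).1 hi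
        have h1 := hr.add_le hlam hp' hq' hi.1.le hi.2
        have h2 := hm (show (i : ℕ) + 1 + 1 ≤ j + 1 by omega)
        simp only at h2
        linarith
      · have hj := (mem_blockLabels j).1 hj
        have h1 := hr.add_le hlam hp' hq' (show p ≤ (j : ℕ) by omega) (show (j : ℕ) < q by omega)
        have h2 := hm (show (i : ℕ) + 1 ≤ j by omega)
        simp only at h2
        linarith
    · rfl
  obtain ⟨c, hc⟩ := hv.exists_abs_truncated_le hg (show 0 < lam / 2 by positivity)
  obtain ⟨hint, hzero⟩ := integral_pairEnergy_updateFinset_eq_zero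
    (hv.measurable_truncated (lam / 2)) (fun y y' s => by simp only [truncated, hv.symm y y'])
    hc (fun s y' => by
      unfold truncated
      split_ifs with h
      · exact hv.integral_eq_zero s (by linarith) y'
      · simp) S x (fun i => volume.restrict (I i))
  set T : (S → ℝ × Y) → ℝ := fun ξ => pairEnergy (truncated v (lam / 2))
    (fun i j => i ∈ S ∨ j ∈ S) (Function.updateFinset x S ξ) with hT
  set K := Real.exp (-(β * outerEnergy a lam v S x)) *
    Real.exp (-(β * (24 * M ^ 3 / lam + lam ^ 2 * S.card))) with hK
  have hvol : (Measure.pi fun i : S => (volume.restrict (I i)).prod μ).real univ =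
      (1 / 8) ^ S.card := by
    rw [measureReal_def, Measure.pi_univ, ENNReal.toReal_prod]
    rw [← Fintype.card_coe S, ← Finset.card_univ, ← Finset.prod_const]
    refine Finset.prod_congr rfl fun i _ => ?_
    rw [← univ_prod_univ, Measure.prod_prod, Measure.restrict_apply_univ, hI, Real.volume_Icc,
      ENNReal.toReal_mul, ENNReal.toReal_ofReal (by linarith)]
    rw [measureReal_def] at hμ
    linarith
  have hfi : Integrable (fun ξ => K * (1 - β * T ξ))
      (Measure.pi fun i : S => (volume.restrict (I i)).prod μ) :=
    ((integrable_const 1).sub (hint.const_mul β)).const_mul K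
  calc ENNReal.ofReal (K * (1 / 8) ^ S.card)
      = ENNReal.ofReal (∫ ξ, K * (1 - β * T ξ)
          ∂(Measure.pi fun i : S => (volume.restrict (I i)).prod μ)) := by
        rw [integral_const_mul, integral_sub (integrable_const 1) (hint.const_mul β),
          integral_const_mul, hzero, integral_const, hvol]
        simp
    _ ≤ ∫⁻ ξ, ENNReal.ofReal (K * (1 - β * T ξ))
          ∂(Measure.pi fun i : S => (volume.restrict (I i)).prod μ) :=
        ofReal_integral_le_lintegral hfi
    _ = ∫⁻ ξ in G, ENNReal.ofReal (K * (1 - β * T ξ))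
          ∂(Measure.pi fun _ : S => (volume : Measure ℝ).prod μ) := by rw [hpi]
    _ ≤ ∫⁻ ξ in G, boltzmann β a lam v N (Function.updateFinset x S ξ)
          ∂(Measure.pi fun _ : S => (volume : Measure ℝ).prod μ) := by
        refine setLIntegral_mono' hGm fun ξ hξ => ?_
        rw [boltzmann, indicator_of_mem (hord ξ hξ)]
        refine ENNReal.ofReal_le_ofReal ?_
        have hout : outerEnergy a lam v S (Function.updateFinset x S ξ) =
            outerEnergy a lam v S x :=
          outerEnergy_congr a lam v fun j hj => by simp [Function.updateFinset, hj]
        rw [reducedEnergy_eq a lam v S, hout, hsep ξ hξ]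
        have hsum := (hrelax ξ hξ).sum_sq_le hlam hM hqN hp hq mem_blockLabels
        rw [← hS] at hsum
        -- This linear bound plays the role of Jensen's inequality: `T` has mean zero over `G`, so
        -- only the volume of `G` survives integration.
        have hexp : 1 - β * T ξ ≤ Real.exp (-(β * T ξ)) := by
          linarith [Real.add_one_le_exp (-(β * T ξ))]
        calc K * (1 - β * T ξ) ≤ K * Real.exp (-(β * T ξ)) := by gcongr
          _ ≤ _ := by
            rw [hK, ← Real.exp_add, ← Real.exp_add]
            refine Real.exp_le_exp.2 ?_
            have := mul_le_mul_of_nonneg_left hsum hβ.le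
            simp only [hT]
            linarith
    _ ≤ _ := by
        rw [lmarginal]
        exact setLIntegral_le_lintegral _ _

end

/-! ### Gaussian tails for a single displacement -/

section

theorem IsGoodLabel.abs_le {M ε : ℝ} {d : ℕ → ℝ} {p : ℕ} (h : IsGoodLabel M ε d p) :
    |d p| ≤ M := by
  have := h p
  simpa using this

theorem sum_pow_comp_le_tsum {r : ℝ} (hr0 : 0 ≤ r) (hr1 : r < 1) (s : Finset ℕ) (e : ℕ → ℕ)
    (he : InjOn e s) : ∑ p ∈ s, r ^ e p ≤ ∑' n : ℕ, r ^ n := by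
  rw [← Finset.sum_image (f := fun n => r ^ n) he]
  exact (summable_geometric_of_lt_one hr0 hr1).sum_le_tsum _ fun _ _ => by positivity

variable {Y : Type*} [MeasurableSpace Y] {μ : Measure Y} {v : Y → Y → ℝ → ℝ} {g : ℝ → ℝ}

section Partition

variable [IsFiniteMeasure μ] {β a lam : ℝ}

theorem blockLabels_univ (N : ℕ) : blockLabels N 0 (N + 1) = Finset.univ := by
  ext j
  simp only [mem_blockLabels, Finset.mem_univ, iff_true]
  omega

/-- The whole system is the block from `0` to `N + 1`, with `M = τ = 0`; the upper bound for blocks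
then bounds the partition function. -/
theorem lintegral_boltzmann_lt_top (hv : IsPairPotential μ v g) (hg : IsDecayProfile g)
    (hβ : 0 < β) (hlam : 0 < lam) (hμ : μ.real univ * lam = 1) (N : ℕ) :
    ∫⁻ ω, boltzmann β a lam v N ω ∂(Measure.pi fun _ => (volume : Measure ℝ).prod μ) < ∞ := by
  obtain ⟨G, -, hG⟩ := hg.exists_sum_le (c := lam / 2) (by positivity)
  have : Nonempty Y := by
    by_contra h
    rw [not_nonempty_iff] at h
    rw [measureReal_def, univ_eq_empty_iff.2 h] at hμ
    simp at hμ
  let x : Fin N → ℝ × Y := fun _ => (0, Classical.arbitrary Y)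
  have h := lmarginal_indicator_boltzmann_le (a := a) (M := 0) (τ := 0) (p := 0) (q := N + 1)
    (E := univ) hv hg hβ hlam le_rfl hG (by omega) le_rfl
    (fun ω _ => ⟨Or.inl rfl, Or.inl rfl, Finset.sum_nonneg fun _ _ => sq_nonneg _⟩) x
  rw [indicator_univ, blockLabels_univ, lmarginal_univ] at h
  exact h.trans_lt ENNReal.ofReal_lt_top

theorem lintegral_boltzmann_pos (hv : IsPairPotential μ v g) (hg : IsDecayProfile g)
    (hβ : 0 < β) (hlam : 0 < lam) (hμ : μ.real univ * lam = 1) (N : ℕ) :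
    0 < ∫⁻ ω, boltzmann β a lam v N ω ∂(Measure.pi fun _ => (volume : Measure ℝ).prod μ) := by
  have : Nonempty Y := by
    by_contra h
    rw [not_nonempty_iff] at h
    rw [measureReal_def, univ_eq_empty_iff.2 h] at hμ
    simp at hμ
  let x : Fin N → ℝ × Y := fun j => (a + lam * ((j : ℝ) + 1 / 2), Classical.arbitrary Y)
  have hx : x ∈ orderedConfigs Y a (a + lam * N) N := by
    refine ⟨fun i j hij => ?_, fun j => ⟨?_, ?_⟩⟩
    · have : ((i : ℕ) : ℝ) < (j : ℕ) := by exact_mod_cast hij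
      simp only [x]
      gcongr
    · have : 0 < lam * ((j : ℝ) + 1 / 2) := by positivity
      simp only [x]
      linarith
    · have : ((j : ℕ) : ℝ) + 1 ≤ N := by exact_mod_cast j.2
      have h2 : lam * ((j : ℝ) + 1 / 2) < lam * N := by gcongr; linarith
      simp only [x]
      linarith
  have h := le_lmarginal_boltzmann (M := 0) (p := 0) (q := N + 1) hv hg hβ hlam le_rfl hμ
    (by omega) le_rfl hx (by rw [displacement_zero]; simp)
    (by rw [displacement_of_lt _ (Nat.lt_succ_self N)]; simp) (by push_cast; rw [sub_zero]; positivity)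
  rw [blockLabels_univ, lmarginal_univ] at h
  refine lt_of_lt_of_le ?_ h
  rw [ENNReal.ofReal_pos]
  positivity

end Partition

/-- The two bounds are compared for fixed outer particles, where the factor containing the outer
energy cancels; integration over the outer particles follows. -/
theorem lintegral_indicator_block_le [IsFiniteMeasure μ] (hv : IsPairPotential μ v g)
    (hg : IsDecayProfile g) {β a lam M G τ : ℝ} (hβ : 0 < β) (hlam : 0 < lam) (hM : 0 ≤ M)
    (hμ : μ.real univ * lam = 1)
    (hG : ∀ n : ℕ, ∑ r ∈ Finset.range n, g (lam / 2 * ((r : ℝ) + 1)) ≤ G)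
    {N p q : ℕ} (hpq : p < q) (hqN : q ≤ N + 1) (hlen : M ≤ lam / 8 * (q - p))
    {E : Set (Fin N → ℝ × Y)} (hEm : MeasurableSet E)
    (hE : ∀ ω ∈ E, (p = 0 ∨ IsGoodLabel M (lam / 8) (displacement a lam ω) p) ∧
      (q = N + 1 ∨ IsGoodLabel M (lam / 8) (displacement a lam ω) q) ∧
      τ ≤ ∑ j ∈ blockLabels N p q, displacement a lam ω (j + 1) ^ 2) :
    ∫⁻ ω, E.indicator (boltzmann β a lam v N) ω
        ∂(Measure.pi fun _ => (volume : Measure ℝ).prod μ) ≤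
      ENNReal.ofReal (Real.exp (β * (2 * g 0 * (8 * M / lam) ^ 2) + β * (24 * M ^ 3 / lam)) *
        (8 * (μ.real univ * √(Real.pi / (β / 8))) *
          Real.exp (β * (2 * G + (16 * g 0 / lam) ^ 2 + lam ^ 2))) ^ (blockLabels N p q).card *
        Real.exp (-(β / 8 * τ))) *
      ∫⁻ ω, boltzmann β a lam v N ω ∂(Measure.pi fun _ => (volume : Measure ℝ).prod μ) := by
  set S := blockLabels N p q with hS
  have hbm := measurable_boltzmann β a lam hv.measurable N
  rw [← lintegral_const_mul _ hbm]
  refine lintegral_le_of_lmarginal_le (μ := fun _ => (volume : Measure ℝ).prod μ) S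
    (hbm.indicator hEm) (hbm.const_mul _) fun x => ?_
  have hconst : ∀ (c : ℝ≥0∞) (x : Fin N → ℝ × Y),
      (∫⋯∫⁻_S, (fun ω => c * boltzmann β a lam v N ω)
        ∂(fun _ => (volume : Measure ℝ).prod μ)) x =
      c * (∫⋯∫⁻_S, boltzmann β a lam v N ∂(fun _ => (volume : Measure ℝ).prod μ)) x := by
    intro c x
    exact lintegral_const_mul c (hbm.comp measurable_updateFinset)
  rw [hconst]
  -- Both marginals depend on the outer coordinates only, so `x` may be replaced by any completion
  -- that is ordered and lies in `E`. If there is none, the left side vanishes.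
  by_cases hex : ∃ ξ : S → ℝ × Y, Function.updateFinset x S ξ ∈ E ∧
      Function.updateFinset x S ξ ∈ orderedConfigs Y a (a + lam * N) N
  · obtain ⟨ξ, hξE, hξO⟩ := hex
    set ω := Function.updateFinset x S ξ with hω
    have hcongr : ∀ j ∉ S, x j = ω j := fun j hj => by simp [hω, Function.updateFinset, hj]
    rw [lmarginal_congr _ _ hcongr, lmarginal_congr _ (boltzmann β a lam v N) hcongr]
    obtain ⟨hp, hq, -⟩ := hE ω hξE
    have hp' : |displacement a lam ω p| ≤ M := by
      rcases hp with rfl | hp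
      · rw [displacement_zero]; simpa
      · exact hp.abs_le
    have hq' : |displacement a lam ω q| ≤ M := by
      rcases hq with rfl | hq
      · rw [displacement_of_lt _ (Nat.lt_succ_self N)]; simpa
      · exact hq.abs_le
    have hup := lmarginal_indicator_boltzmann_le hv hg hβ hlam hM hG hpq hqN hE ω
    have hlow := le_lmarginal_boltzmann hv hg hβ hlam hM hμ hpq hqN hξO hp' hq' hlen
    refine hup.trans (le_trans (le_of_eq ?_) (mul_le_mul_right hlow _))
    rw [← ENNReal.ofReal_mul (by positivity)]
    congr 1
    rw [← hS]
    simp only [mul_pow, ← Real.exp_nat_mul]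
    have h8 : (8 : ℝ) ^ S.card * (1 / 8) ^ S.card = 1 := by rw [← mul_pow]; norm_num
    have : ∀ A B C D F J e8 i8 : ℝ, e8 * i8 = 1 → Real.exp A * Real.exp B * J =
        Real.exp C * (e8 * J * Real.exp D) * Real.exp (B - C - D - F) *
          (Real.exp A * Real.exp F * i8) := by
      intro A B C D F J e8 i8 h
      have : Real.exp B = Real.exp C * Real.exp D * Real.exp (B - C - D - F) * Real.exp F := by
        simp only [← Real.exp_add]; congr 1; ring
      rw [this]
      linear_combination (-(Real.exp A * Real.exp C * Real.exp D *
        Real.exp (B - C - D - F) * Real.exp F * J)) * h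
    rw [this _ _ (β * (2 * g 0 * (8 * M / lam) ^ 2) + β * (24 * M ^ 3 / lam))
      (S.card * (β * (2 * G + (16 * g 0 / lam) ^ 2 + lam ^ 2)))
      (-(β * (24 * M ^ 3 / lam + lam ^ 2 * S.card))) _ _ _ h8, ← mul_pow]
    congr 3
    ring
  · have : (∫⋯∫⁻_S, E.indicator (boltzmann β a lam v N)
        ∂(fun _ => (volume : Measure ℝ).prod μ)) x = 0 := by
      rw [lmarginal, ← lintegral_zero (μ := Measure.pi fun _ : S => (volume : Measure ℝ).prod μ)]
      congr 1
      funext ξ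
      by_cases h1 : Function.updateFinset x S ξ ∈ E
      · rw [indicator_of_mem h1, boltzmann, indicator_of_notMem fun h2 => hex ⟨ξ, h1, h2⟩]
      · rw [indicator_of_notMem h1]
    rw [this]
    exact zero_le

theorem measurableSet_isGoodLabel (M ε a lam : ℝ) (N p : ℕ) :
    MeasurableSet {ω : Fin N → ℝ × Y | IsGoodLabel M ε (displacement a lam ω) p} := by
  have : {ω : Fin N → ℝ × Y | IsGoodLabel M ε (displacement a lam ω) p} =
      ⋂ u : ℕ, {ω | |displacement a lam ω u| ≤ M + ε * |(u : ℝ) - p|} := by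
    ext ω; simp [IsGoodLabel]
  rw [this]
  exact MeasurableSet.iInter fun u =>
    measurableSet_le (measurable_displacement u).abs measurable_const

/-- Configurations for which the block between `p` and `q` has moderately displaced surroundings
and sum of squared displacements at least `τ`. -/
def blockEvent (Y : Type*) (M a lam τ : ℝ) (N p q : ℕ) : Set (Fin N → ℝ × Y) :=
  {ω | (p = 0 ∨ IsGoodLabel M (lam / 8) (displacement a lam ω) p) ∧
    (q = N + 1 ∨ IsGoodLabel M (lam / 8) (displacement a lam ω) q) ∧
    τ ≤ ∑ j ∈ blockLabels N p q, displacement a lam ω (j + 1) ^ 2}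

theorem measurableSet_blockEvent (M a lam τ : ℝ) (N p q : ℕ) :
    MeasurableSet (blockEvent Y M a lam τ N p q) := by
  refine MeasurableSet.inter ?_ (MeasurableSet.inter ?_ ?_)
  · exact (MeasurableSet.const _).union (measurableSet_isGoodLabel _ _ _ _ _ _)
  · exact (MeasurableSet.const _).union (measurableSet_isGoodLabel _ _ _ _ _ _)
  · exact measurableSet_le measurable_const
      (Finset.measurable_sum _ fun j _ => (measurable_displacement _).pow_const 2)

/-- Gaussian tails for the displacement of a single particle. -/
theorem exists_displacement_tail {β lam : ℝ} (hβ : 0 < β) (hlam : 0 < lam) {g : ℝ → ℝ}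
    (hg : IsDecayProfile g) :
    ∃ C A : ℝ, 0 < A ∧ 1 ≤ C ∧ ∀ {Y : Type} [MeasurableSpace Y] {μ : Measure Y} [IsFiniteMeasure μ]
      {v : Y → Y → ℝ → ℝ}, IsPairPotential μ v g → μ.real univ * lam = 1 →
      ∀ (a : ℝ) {N u₀ : ℕ}, 1 ≤ u₀ → u₀ ≤ N → ∀ γ : ℝ, 0 ≤ γ →
      ∫⁻ ω, {ω | γ ≤ |displacement a lam ω u₀|}.indicator (boltzmann β a lam v N) ω
          ∂(Measure.pi fun _ => (volume : Measure ℝ).prod μ) ≤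
        ENNReal.ofReal (C * Real.exp (-(A * γ ^ 2))) *
          ∫⁻ ω, boltzmann β a lam v N ω ∂(Measure.pi fun _ => (volume : Measure ℝ).prod μ) := by
  obtain ⟨G, -, hG⟩ := hg.exists_sum_le (c := lam / 2) (by positivity)
  set J := 8 * (lam⁻¹ * √(Real.pi / (β / 8))) *
    Real.exp (β * (2 * G + (16 * g 0 / lam) ^ 2 + lam ^ 2)) with hJdef
  have hJ : 0 < J := by positivity
  -- With `κ = 16B/β` the elastic factor for a block of length `l` is `exp (-B l)`, which beats `J ^
  -- l` with `exp (-l)` to spare.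
  obtain ⟨B, hB0, hBJ⟩ : ∃ B : ℝ, 0 < B ∧ J ≤ Real.exp (B - 1) :=
    ⟨max 1 (Real.log J + 1), by positivity, by
      rw [← Real.log_le_iff_le_exp hJ]
      linarith [le_max_right 1 (Real.log J + 1)]⟩
  -- `M` is taken so large that the length bound of `exists_block` with `ε = λ/8` becomes `κ l ≤ ∑
  -- d²`.
  obtain ⟨M, hM1, hM⟩ : ∃ M : ℝ, 1 ≤ M ∧ (2 / (lam / 8 * M) + 1 / M ^ 2) * (16 * B / β) ≤ 1 := by
    refine ⟨max 1 ((16 / lam + 1) * (16 * B / β)), le_max_left _ _, ?_⟩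
    set M := max 1 ((16 / lam + 1) * (16 * B / β)) with hMdef
    have h1 : 1 ≤ M := le_max_left _ _
    have h2 : (16 / lam + 1) * (16 * B / β) ≤ M := le_max_right _ _
    have h3 : 1 / M ^ 2 ≤ 1 / M := by
      apply one_div_le_one_div_of_le <;> nlinarith
    have h4 : 2 / (lam / 8 * M) = 16 / lam * (1 / M) := by field_simp; norm_num
    have h5 : 0 < 16 * B / β := by positivity
    calc _ ≤ ((16 / lam + 1) * (1 / M)) * (16 * B / β) := by
          rw [h4]; gcongr; linarith
      _ = ((16 / lam + 1) * (16 * B / β)) / M := by ring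
      _ ≤ 1 := (div_le_one (by linarith)).2 h2
  have hMpos : 0 < M := by linarith
  set H := ∑' n : ℕ, Real.exp (-1) ^ n
  set C₀ := Real.exp (β * (2 * g 0 * (8 * M / lam) ^ 2) + β * (24 * M ^ 3 / lam))
  set A := β / 16 with hA
  refine ⟨max (Real.exp (A * (9 * M + 1) ^ 2)) (C₀ * Real.exp 1 * (H * H)), A, by positivity,
    le_max_of_le_left (Real.one_le_exp (by positivity)), ?_⟩
  intro Y _ μ _ v hv hμ a N u₀ hu1 huN γ hγ
  set Z := ∫⁻ ω, boltzmann β a lam v N ω ∂(Measure.pi fun _ => (volume : Measure ℝ).prod μ)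
  -- Below the threshold the constant alone makes the bound trivial. Above it `|d u₀| - M ≥ 8M`, so
  -- the block has room for the boundary displacements to relax: `M ≤ (λ/8)(q - p)`.
  rcases lt_or_ge γ (9 * M + 1) with hsmall | hlarge
  · calc _ ≤ Z := lintegral_mono fun ω => indicator_le_self _ _ ω
      _ ≤ 1 * Z := by rw [one_mul]
      _ ≤ _ := by
        gcongr
        rw [← ENNReal.ofReal_one]
        refine ENNReal.ofReal_le_ofReal ?_
        calc (1 : ℝ) = Real.exp (A * γ ^ 2) * Real.exp (-(A * γ ^ 2)) := by
              rw [← Real.exp_add]; simp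
          _ ≤ _ := by
              gcongr
              refine le_max_of_le_left (Real.exp_le_exp.2 ?_)
              gcongr
  set κ := 16 * B / β with hκ
  -- The sum of the squared displacements over the block is at least `κ l` and at least `γ²`; `τ` is
  -- the mean of these two bounds.
  set τ : ℕ → ℕ → ℝ := fun p q => (κ * ((q - p - 1 : ℕ) : ℝ) + γ ^ 2) / 2 with hτ
  set E : ℕ → ℕ → Set (Fin N → ℝ × Y) := fun p q =>
    if M ≤ lam / 8 * ((q : ℝ) - p) then blockEvent Y M a lam (τ p q) N p q else ∅ with hE
  have hEm : ∀ p q, MeasurableSet (E p q) := by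
    intro p q
    simp only [hE]
    split_ifs
    · exact measurableSet_blockEvent _ _ _ _ _ _ _
    · exact MeasurableSet.empty
  have hμ' : μ.real univ = lam⁻¹ := eq_inv_of_mul_eq_one_left hμ
  have hbm := measurable_boltzmann β a lam hv.measurable N
  have hcover : ∀ ω ∈ orderedConfigs Y a (a + lam * N) N, γ ≤ |displacement a lam ω u₀| →
      ∃ p ∈ Finset.range u₀, ∃ q ∈ Finset.Ioc u₀ (N + 1), ω ∈ E p q := by
    intro ω hω hγω
    obtain ⟨p, q, hp, hq, hqN, hpg, hqg, hl⟩ := exists_block hMpos (show 0 < lam / 8 by positivity)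
      (displacement_zero ω) (fun u hu => displacement_of_lt (a := a) (lam := lam) ω hu) hu1 huN
      (by linarith)
    refine ⟨p, Finset.mem_range.2 hp, q, Finset.mem_Ioc.2 ⟨hq, hqN⟩, ?_⟩
    have hp' : |displacement a lam ω p| ≤ M := by
      rcases hpg with rfl | hp
      · rw [displacement_zero]; simpa using hMpos.le
      · exact hp.abs_le
    have hq' : |displacement a lam ω q| ≤ M := by
      rcases hqg with rfl | hq
      · rw [displacement_of_lt _ (Nat.lt_succ_self N)]; simpa using hMpos.le
      · exact hq.abs_le
    have hlen := abs_sub_le_mul_of_between hlam (strictMono_of_mem_orderedConfigs hlam hω) hp' hq'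
      hp hq
    simp only [hE]
    rw [if_pos (by linarith)]
    refine ⟨hpg, hqg, ?_⟩
    rw [sum_blockLabels hqN (fun u => displacement a lam ω u ^ 2)]
    rw [← Finset.mul_sum] at hl
    have h1 : γ ^ 2 ≤ ∑ u ∈ Finset.Ioo p q, displacement a lam ω u ^ 2 := by
      refine le_trans ?_ (Finset.single_le_sum (f := fun u => displacement a lam ω u ^ 2)
        (fun _ _ => sq_nonneg _) (Finset.mem_Ioo.2 ⟨hp, hq⟩))
      rw [← sq_abs (displacement a lam ω u₀)]
      gcongr
    have h2 : κ * ((q - p - 1 : ℕ) : ℝ) ≤ ∑ u ∈ Finset.Ioo p q, displacement a lam ω u ^ 2 := by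
      set s := ∑ u ∈ Finset.Ioo p q, displacement a lam ω u ^ 2
      have hs : 0 ≤ s := Finset.sum_nonneg fun _ _ => sq_nonneg _
      have hκ0 : 0 < κ := by positivity
      calc κ * ((q - p - 1 : ℕ) : ℝ) ≤ κ * ((2 / (lam / 8 * M) + 1 / M ^ 2) * s) := by gcongr
        _ = ((2 / (lam / 8 * M) + 1 / M ^ 2) * κ) * s := by ring
        _ ≤ 1 * s := by gcongr
        _ = s := one_mul s
    simp only [hτ]
    linarith
  have hterm : ∀ p ∈ Finset.range u₀, ∀ q ∈ Finset.Ioc u₀ (N + 1),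
      ∫⁻ ω, (E p q).indicator (boltzmann β a lam v N) ω
        ∂(Measure.pi fun _ => (volume : Measure ℝ).prod μ) ≤
      ENNReal.ofReal (C₀ * Real.exp 1 * Real.exp (-(A * γ ^ 2)) *
        (Real.exp (-1) ^ (u₀ - p) * Real.exp (-1) ^ (q - u₀))) * Z := by
    intro p hp q hq
    rw [Finset.mem_range] at hp
    rw [Finset.mem_Ioc] at hq
    simp only [hE]
    split_ifs with hlen
    · refine (lintegral_indicator_block_le hv hg hβ hlam hMpos.le hμ hG (by omega) hq.2 hlen
        (measurableSet_blockEvent _ _ _ _ _ _ _) fun ω hω => hω).trans ?_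
      refine mul_le_mul_left (ENNReal.ofReal_le_ofReal ?_) _
      rw [hμ', ← hJdef, card_blockLabels hq.2, ← pow_add]
      set l := q - p - 1 with hl
      -- The factor `exp (-l)` thus splits, up to `exp 1`, into decay on either side of `u₀`, and
      -- the double sum over `p` and `q` factorizes.
      have hl' : u₀ - p + (q - u₀) = l + 1 := by omega
      rw [hl']
      calc C₀ * J ^ l * Real.exp (-(β / 8 * τ p q))
          ≤ C₀ * Real.exp (B - 1) ^ l * Real.exp (-(β / 8 * τ p q)) := by gcongr
        _ = C₀ * Real.exp 1 * Real.exp (-(A * γ ^ 2)) * Real.exp (-1) ^ (l + 1) := by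
          simp only [← Real.exp_nat_mul, mul_assoc, ← Real.exp_add]
          congr 2
          simp only [hτ, hκ, hA, ← hl]
          push_cast
          field_simp
          ring
    · simp
  calc ∫⁻ ω, {ω | γ ≤ |displacement a lam ω u₀|}.indicator (boltzmann β a lam v N) ω
          ∂(Measure.pi fun _ => (volume : Measure ℝ).prod μ)
      ≤ ∫⁻ ω, ∑ p ∈ Finset.range u₀, ∑ q ∈ Finset.Ioc u₀ (N + 1),
          (E p q).indicator (boltzmann β a lam v N) ω
          ∂(Measure.pi fun _ => (volume : Measure ℝ).prod μ) := by
        refine lintegral_mono fun ω => ?_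
        refine indicator_apply_le' (fun hω => ?_) fun _ => bot_le
        by_cases hO : ω ∈ orderedConfigs Y a (a + lam * N) N
        · obtain ⟨p, hp, q, hq, hmem⟩ := hcover ω hO hω
          calc boltzmann β a lam v N ω = (E p q).indicator (boltzmann β a lam v N) ω := by
                rw [indicator_of_mem hmem]
            _ ≤ ∑ q ∈ Finset.Ioc u₀ (N + 1), (E p q).indicator (boltzmann β a lam v N) ω :=
                Finset.single_le_sum (f := fun q => (E p q).indicator (boltzmann β a lam v N) ω)
                  (fun _ _ => zero_le) hq
            _ ≤ _ := Finset.single_le_sum (f := fun p => ∑ q ∈ Finset.Ioc u₀ (N + 1),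
                  (E p q).indicator (boltzmann β a lam v N) ω) (fun _ _ => zero_le) hp
        · rw [boltzmann, indicator_of_notMem hO]
          exact zero_le
    _ = ∑ p ∈ Finset.range u₀, ∑ q ∈ Finset.Ioc u₀ (N + 1),
          ∫⁻ ω, (E p q).indicator (boltzmann β a lam v N) ω
          ∂(Measure.pi fun _ => (volume : Measure ℝ).prod μ) := by
        rw [lintegral_finsetSum _ fun p _ =>
          Finset.measurable_sum _ fun q _ => hbm.indicator (hEm p q)]
        refine Finset.sum_congr rfl fun p _ => ?_
        rw [lintegral_finsetSum _ fun q _ => hbm.indicator (hEm p q)]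
    _ ≤ ∑ p ∈ Finset.range u₀, ∑ q ∈ Finset.Ioc u₀ (N + 1),
          ENNReal.ofReal (C₀ * Real.exp 1 * Real.exp (-(A * γ ^ 2)) *
            (Real.exp (-1) ^ (u₀ - p) * Real.exp (-1) ^ (q - u₀))) * Z :=
        Finset.sum_le_sum fun p hp => Finset.sum_le_sum fun q hq => hterm p hp q hq
    _ = ENNReal.ofReal (C₀ * Real.exp 1 * Real.exp (-(A * γ ^ 2)) *
          ((∑ p ∈ Finset.range u₀, Real.exp (-1) ^ (u₀ - p)) *
            ∑ q ∈ Finset.Ioc u₀ (N + 1), Real.exp (-1) ^ (q - u₀))) * Z := by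
        simp only [← Finset.sum_mul]
        congr 1
        rw [Finset.sum_mul_sum, Finset.mul_sum, ENNReal.ofReal_sum_of_nonneg fun p _ => by positivity]
        refine Finset.sum_congr rfl fun p _ => ?_
        rw [Finset.mul_sum, ENNReal.ofReal_sum_of_nonneg fun q _ => by positivity]
    _ ≤ ENNReal.ofReal (max (Real.exp (A * (9 * M + 1) ^ 2)) (C₀ * Real.exp 1 * (H * H)) *
          Real.exp (-(A * γ ^ 2))) * Z := by
        refine mul_le_mul_left (ENNReal.ofReal_le_ofReal ?_) _
        have hr0 : 0 ≤ Real.exp (-1) := (Real.exp_pos _).le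
        have hr1 : Real.exp (-1) < 1 := by rw [Real.exp_lt_one_iff]; norm_num
        have s1 := sum_pow_comp_le_tsum hr0 hr1 (Finset.range u₀) (fun p => u₀ - p) (by
          intro i hi j hj h
          have hi := Finset.mem_range.1 (Finset.mem_coe.1 hi)
          have hj := Finset.mem_range.1 (Finset.mem_coe.1 hj)
          dsimp only at h
          omega)
        have s2 := sum_pow_comp_le_tsum hr0 hr1 (Finset.Ioc u₀ (N + 1)) (fun q => q - u₀) (by
          intro i hi j hj h
          have hi := Finset.mem_Ioc.1 (Finset.mem_coe.1 hi)
          have hj := Finset.mem_Ioc.1 (Finset.mem_coe.1 hj)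
          dsimp only at h
          omega)
        have hH : 0 ≤ H := le_trans (Finset.sum_nonneg fun _ _ => by positivity) s1
        calc _ ≤ C₀ * Real.exp 1 * Real.exp (-(A * γ ^ 2)) * (H * H) := by
              gcongr
          _ = (C₀ * Real.exp 1 * (H * H)) * Real.exp (-(A * γ ^ 2)) := by ring
          _ ≤ _ := by gcongr; exact le_max_right _ _

end

/-! ### From the tube to the reduced energy -/

namespace CrossSection

variable {k : ℕ} (D : CrossSection k)

theorem measurableSet_carrier : MeasurableSet D.carrier :=
  D.isOpen_lift.measurableSet.inter D.measurableSet_cell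

instance isFiniteMeasure_restrict_carrier :
    IsFiniteMeasure ((volume : Measure (Space k)).restrict D.carrier) :=
  ⟨by rw [Measure.restrict_apply_univ]; exact D.isBounded.measure_lt_top⟩

theorem real_univ_restrict_carrier :
    ((volume : Measure (Space k)).restrict D.carrier).real univ = D.width := by
  rw [measureReal_def, Measure.restrict_apply_univ]
  rfl

open Classical in
/-- The short-range part of the potential, extended by zero. -/
def shortRangeExt {ι : Type} (E : ι → ℝ) (φ : ι → Space k → ℝ) (y y' : Space k) (s : ℝ) : ℝ :=
  if 0 < s ∧ y ∈ D.carrier ∧ y' ∈ D.carrier then shortRange E φ y y' s else 0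

variable {D} {ι : Type} {E : ι → ℝ} {φ : ι → Space k → ℝ} {g : ℝ → ℝ}

theorem shortRangeExt_of_mem {y y' : Space k} {s : ℝ} (hs : 0 < s) (hy : y ∈ D.carrier)
    (hy' : y' ∈ D.carrier) : D.shortRangeExt E φ y y' s = shortRange E φ y y' s :=
  if_pos ⟨hs, hy, hy'⟩

theorem IsAdmissible.measurable_shortRangeExt [Countable ι] (h : D.IsAdmissible E φ g) :
    Measurable fun z : Space k × Space k × ℝ => D.shortRangeExt E φ z.1 z.2.1 z.2.2 := by
  classical
  have hφ : ∀ n, Measurable (D.carrier.indicator (φ n)) := by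
    intro n
    have hc : ContinuousOn (φ n) D.carrier := (h.eigenbasis.continuousOn n).mono inter_subset_left
    rw [← piecewise_eq_indicator]
    exact hc.measurable_piecewise continuousOn_const D.measurableSet_carrier
  let t : ι → Space k × Space k × ℝ → ℝ := fun n z => if 0 < z.2.2 then
    shortRangeTerm E (fun n => D.carrier.indicator (φ n)) z.1 z.2.1 z.2.2 n else 0
  have ht : ∀ n, Measurable (t n) := by
    intro n
    refine Measurable.ite (measurableSet_lt measurable_const (by fun_prop)) ?_ measurable_const
    have h1 := (hφ n).comp (measurable_fst : Measurable fun z : Space k × Space k × ℝ => z.1)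
    have h2 := (hφ n).comp
      (measurable_fst.comp measurable_snd : Measurable fun z : Space k × Space k × ℝ => z.2.1)
    unfold shortRangeTerm
    exact Measurable.mul (by fun_prop) (h1.mul h2)
  -- The finite partial sums form a net over finite sets of indices, along which pointwise limits
  -- preserve measurability because the index type is countable.
  refine measurable_of_tendsto_metrizable' (atTop : Filter (Finset ι))
    (f := fun s z => ∑ n ∈ s, t n z) (fun s => Finset.measurable_sum _ fun n _ => ht n) ?_
  rw [tendsto_pi_nhds]
  intro z
  change HasSum (fun n => t n z) _
  by_cases hz : 0 < z.2.2 ∧ z.1 ∈ D.carrier ∧ z.2.1 ∈ D.carrier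
  · rw [shortRangeExt, if_pos hz]
    have : (fun n => t n z) = shortRangeTerm E φ z.1 z.2.1 z.2.2 := by
      funext n
      simp [t, hz.1, shortRangeTerm, hz.2.1, hz.2.2]
    rw [this]
    exact (h.summable _ hz.1 _ hz.2.1 _ hz.2.2).hasSum
  · rw [shortRangeExt, if_neg hz]
    have : (fun n => t n z) = fun _ => 0 := by
      funext n
      by_cases h1 : 0 < z.2.2 <;> by_cases h2 : z.1 ∈ D.carrier <;>
        by_cases h3 : z.2.1 ∈ D.carrier <;> simp_all [t, shortRangeTerm]
    rw [this]
    exact hasSum_zero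

theorem IsAdmissible.isPairPotential [Countable ι] (h : D.IsAdmissible E φ g)
    (hg : IsDecayProfile g) :
    IsPairPotential (volume.restrict D.carrier) (D.shortRangeExt E φ) g where
  measurable := h.measurable_shortRangeExt
  symm y y' s := by
    have : shortRange E φ y y' s = shortRange E φ y' y s := by
      simp only [shortRange, shortRangeTerm, mul_comm (φ _ y)]
    by_cases h1 : y ∈ D.carrier <;> by_cases h2 : y' ∈ D.carrier <;>
      simp [shortRangeExt, this, h1, h2]
  lower_bound s hs y y' := by
    have := hg.pos s hs.le
    unfold shortRangeExt
    split_ifs with hz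
    · exact h.lower_bound s hs y hz.2.1 y' hz.2.2
    · linarith
  bounded ε hε := by
    obtain ⟨c, hc, hle⟩ := h.upper_bound ε hε
    have h0 := hg.pos 0 le_rfl
    refine ⟨c * g 0, fun s hs y y' => ?_⟩
    have : g s ≤ g 0 := hg.antitone (by simp) (hε.le.trans hs) (hε.le.trans hs)
    unfold shortRangeExt
    split_ifs with hz
    · exact (hle s hs y hz.2.1 y' hz.2.2).trans (by gcongr)
    · positivity
  integral_eq_zero s hs y' := by
    by_cases hy' : y' ∈ D.carrier
    · rw [← h.average_zero s hs y' hy']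
      exact setIntegral_congr_fun D.measurableSet_carrier fun y hy =>
        shortRangeExt_of_mem hs hy hy'
    · simp [shortRangeExt, hy']

end CrossSection

/-- The potential has no uniform upper bound near distance zero. On each slice, however, `|v| ≤ v +
2 g(0)` and `v` has mean zero, so the `L¹` norms of the slices are bounded by `2 g(0) μ(Y)`, which
gives integrability and permits Fubini. -/
theorem IsPairPotential.integral_prod_eq_zero {Y : Type*} [MeasurableSpace Y] {μ : Measure Y}
    [IsFiniteMeasure μ] {v : Y → Y → ℝ → ℝ} {g : ℝ → ℝ} (hv : IsPairPotential μ v g)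
    (hg : IsDecayProfile g) (ρ : Measure ℝ) [IsFiniteMeasure ρ] (z : ℝ × Y) (hz : ρ {z.1} = 0) :
    Integrable (fun z' : ℝ × Y => v z.2 z'.2 |z.1 - z'.1|) (ρ.prod μ) ∧
      ∫ z', v z.2 z'.2 |z.1 - z'.1| ∂(ρ.prod μ) = 0 := by
  have hm : Measurable fun z' : ℝ × Y => v z.2 z'.2 |z.1 - z'.1| :=
    hv.measurable.comp (f := fun z' : ℝ × Y => (z.2, z'.2, |z.1 - z'.1|)) (by fun_prop)
  have hne : ∀ᵐ t ∂ρ, t ≠ z.1 := by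
    rw [ae_iff]
    simpa using hz
  have hg0 := hg.pos 0 le_rfl
  have hsec : ∀ t ≠ z.1, Integrable (fun y => v z.2 y |z.1 - t|) μ ∧
      ∫ y, v z.2 y |z.1 - t| ∂μ = 0 ∧ ∀ y, |(v z.2 y |z.1 - t|)| ≤ v z.2 y |z.1 - t| + 2 * g 0 := by
    intro t ht
    have hs : 0 < |z.1 - t| := abs_pos.2 (sub_ne_zero.2 (Ne.symm ht))
    have hle : ∀ y, -g 0 ≤ v z.2 y |z.1 - t| := fun y => by
      have h1 := hv.lower_bound _ hs z.2 y
      have h2 : g |z.1 - t| ≤ g 0 := hg.antitone (by simp) hs.le hs.le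
      linarith
    obtain ⟨c, hc⟩ := hv.bounded _ hs
    refine ⟨?_, ?_, fun y => ?_⟩
    · refine Integrable.of_bound (C := max c (g 0))
        (hm.comp (measurable_prodMk_left (x := t))).aestronglyMeasurable
        (Eventually.of_forall fun y => ?_)
      rw [Real.norm_eq_abs, abs_le]
      exact ⟨by linarith [le_max_right c (g 0), hle y], (hc _ le_rfl _ _).trans (le_max_left _ _)⟩
    · simp only [hv.symm z.2]
      exact hv.integral_eq_zero _ hs z.2
    · rw [abs_le]
      constructor <;> linarith [hle y]
  have hint : Integrable (fun z' : ℝ × Y => v z.2 z'.2 |z.1 - z'.1|) (ρ.prod μ) := by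
    rw [integrable_prod_iff hm.aestronglyMeasurable]
    refine ⟨hne.mono fun t ht => (hsec t ht).1, ?_⟩
    refine Integrable.of_bound (C := 2 * g 0 * μ.real univ)
      hm.norm.stronglyMeasurable.integral_prod_right.aestronglyMeasurable
      (hne.mono fun t ht => ?_)
    obtain ⟨h1, h2, h3⟩ := hsec t ht
    rw [Real.norm_of_nonneg (integral_nonneg fun _ => norm_nonneg _)]
    calc ∫ y, ‖v z.2 y |z.1 - t|‖ ∂μ ≤ ∫ y, (v z.2 y |z.1 - t| + 2 * g 0) ∂μ :=
          integral_mono h1.norm (h1.add (integrable_const _)) h3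
      _ = 2 * g 0 * μ.real univ := by
          rw [integral_add h1 (integrable_const _), h2, integral_const, smul_eq_mul]; ring
  refine ⟨hint, ?_⟩
  rw [integral_prod _ hint]
  exact integral_eq_zero_of_ae (hne.mono fun t ht => (hsec t ht).2.1)

theorem integral_abs_sub_Icc {a b x : ℝ} (ha : a ≤ x) (hb : x ≤ b) :
    ∫ t in Icc a b, |x - t| = ((x - a) ^ 2 + (b - x) ^ 2) / 2 := by
  have hi : ∀ c d : ℝ, IntervalIntegrable (fun t => |x - t|) volume c d := fun c d =>
    Continuous.intervalIntegrable (by fun_prop) _ _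
  rw [integral_Icc_eq_integral_Ioc, ← intervalIntegral.integral_of_le (ha.trans hb),
    ← intervalIntegral.integral_add_adjacent_intervals (hi a x) (hi x b)]
  have h1 : ∫ t in a..x, |x - t| = ∫ t in a..x, (x - t) :=
    intervalIntegral.integral_congr fun t ht => by
      rw [uIcc_of_le ha] at ht
      exact abs_of_nonneg (by linarith [ht.2])
  have h2 : ∫ t in x..b, |x - t| = ∫ t in x..b, (t - x) :=
    intervalIntegral.integral_congr fun t ht => by
      rw [uIcc_of_le hb] at ht
      rw [abs_sub_comm]
      exact abs_of_nonneg (by linarith [ht.1])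
  rw [h1, h2, intervalIntegral.integral_comp_sub_left (fun t => t),
    intervalIntegral.integral_comp_sub_right (fun t => t), integral_id, integral_id]
  ring

theorem sum_sum_Ioi_sub {N : ℕ} (x : Fin N → ℝ) :
    ∑ j : Fin N, ∑ l ∈ Finset.Ioi j, (x l - x j) = ∑ j : Fin N, (2 * (j : ℝ) + 1 - N) * x j := by
  have h1 : ∑ j : Fin N, ∑ l ∈ Finset.Ioi j, x l = ∑ l : Fin N, (l : ℝ) * x l := by
    rw [Finset.sum_comm' (t' := Finset.univ) (s' := fun l => Finset.Iio l) (by simp)]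
    refine Finset.sum_congr rfl fun l _ => ?_
    rw [Finset.sum_const, Fin.card_Iio, nsmul_eq_mul]
  simp only [Finset.sum_sub_distrib]
  rw [h1, ← Finset.sum_sub_distrib]
  refine Finset.sum_congr rfl fun j _ => ?_
  have hcard : ((N - 1 - (j : ℕ) : ℕ) : ℝ) = N - 1 - j := by
    rw [Nat.cast_sub (show (j : ℕ) ≤ N - 1 by omega), Nat.cast_sub (Nat.one_le_iff_ne_zero.2 (Fin.pos j).ne'),
      Nat.cast_one]
  rw [Finset.sum_const, Fin.card_Ioi, nsmul_eq_mul, hcard]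
  ring

namespace CrossSection

variable {k : ℕ} {D : CrossSection k} {ι : Type} {E : ι → ℝ} {φ : ι → Space k → ℝ} {g : ℝ → ℝ}

theorem IsAdmissible.integral_coulomb [Countable ι] (h : D.IsAdmissible E φ g)
    (hg : IsDecayProfile g) (hD : 0 < D.width) {a b : ℝ} {z : ℝ × Space k} (hz : z.1 ∈ Icc a b)
    (hy : z.2 ∈ D.carrier) :
    ∫ z' in Icc a b ×ˢ D.carrier, D.coulomb E φ z z' =
      -(((z.1 - a) ^ 2 + (b - z.1) ^ 2) / 4) := by
  obtain ⟨hi, h0⟩ := (h.isPairPotential hg).integral_prod_eq_zero hg (volume.restrict (Icc a b)) z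
    (by simp)
  have hlin : Integrable (fun t : ℝ => -(|z.1 - t| / (2 * D.width))) (volume.restrict (Icc a b)) :=
    (Continuous.integrableOn_Icc (by fun_prop))
  have hlin' := hlin.comp_fst (volume.restrict D.carrier)
  rw [Measure.volume_eq_prod, ← Measure.prod_restrict]
  have hae : ∀ᵐ z' ∂((volume.restrict (Icc a b)).prod (volume.restrict D.carrier)),
      D.coulomb E φ z z' =
        -(|z.1 - z'.1| / (2 * D.width)) + D.shortRangeExt E φ z.2 z'.2 |z.1 - z'.1| := by
    have h1 : ∀ᵐ z' : ℝ × Space k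
        ∂((volume.restrict (Icc a b)).prod (volume.restrict D.carrier)), z'.1 ≠ z.1 := by
      refine Measure.quasiMeasurePreserving_fst.ae (p := fun t => t ≠ z.1) ?_
      rw [ae_iff]
      simp
    have h2 : ∀ᵐ z' : ℝ × Space k
        ∂((volume.restrict (Icc a b)).prod (volume.restrict D.carrier)), z'.2 ∈ D.carrier :=
      Measure.quasiMeasurePreserving_snd.ae (p := fun y => y ∈ D.carrier)
        (ae_restrict_mem D.measurableSet_carrier)
    filter_upwards [h1, h2] with z' h1 h2
    rw [coulomb, shortRangeExt_of_mem (abs_pos.2 (sub_ne_zero.2 (Ne.symm h1))) hy h2]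
  rw [integral_congr_ae hae, integral_add hlin' hi, h0, add_zero,
    integral_fun_fst (f := fun t : ℝ => -(|z.1 - t| / (2 * D.width))), integral_neg,
    integral_div, integral_abs_sub_Icc hz.1 hz.2, real_univ_restrict_carrier, smul_eq_mul]
  field_simp
  ring

/-- Up to a constant, the energy is the sum of the elastic energy of the displacements from the
lattice sites and of the short-range pair energy. -/
theorem IsAdmissible.exists_energy_eq [Countable ι] (h : D.IsAdmissible E φ g)
    (hg : IsDecayProfile g) (hD : 0 < D.width) (a : ℝ) (N : ℕ) :
    ∃ c : ℝ, ∀ ω ∈ D.configSpace a (a + D.spacing * N) N,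
      D.energy E φ a (a + D.spacing * N) ω =
        c + reducedEnergy a D.spacing (D.shortRangeExt E φ) ω := by
  set lam := D.spacing with hlam
  refine ⟨∑ j : Fin N, ((a ^ 2 + (a + lam * N) ^ 2) / 4 -
    (a + lam * ((j : ℝ) + 1 / 2)) ^ 2 / 2), fun ω hω => ?_⟩
  have hpair : ∑ j : Fin N, ∑ l ∈ Finset.Ioi j, D.coulomb E φ (ω j) (ω l) =
      -(lam / 2) * ∑ j : Fin N, (2 * (j : ℝ) + 1 - N) * (ω j).1 +
        pairEnergy (D.shortRangeExt E φ) (fun _ _ => True) ω := by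
    rw [← sum_sum_Ioi_sub fun j => (ω j).1, Finset.mul_sum, pairEnergy, ← Finset.sum_add_distrib]
    refine Finset.sum_congr rfl fun j _ => ?_
    simp only [and_true]
    rw [← Finset.sum_filter, Finset.filter_lt_eq_Ioi, Finset.mul_sum, ← Finset.sum_add_distrib]
    refine Finset.sum_congr rfl fun l hl => ?_
    have hlt : (ω j).1 < (ω l).1 := hω.1 (Finset.mem_Ioi.1 hl)
    have hs : 0 < |(ω j).1 - (ω l).1| := abs_pos.2 (by linarith)
    rw [coulomb, shortRangeExt_of_mem hs (hω.2 j).2 (hω.2 l).2, abs_sub_comm,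
      abs_of_pos (sub_pos.2 hlt), hlam, spacing]
    field_simp
  have hbg : ∀ j : Fin N, ∫ z in Icc a (a + lam * N) ×ˢ D.carrier, D.coulomb E φ (ω j) z =
      -((((ω j).1 - a) ^ 2 + (a + lam * N - (ω j).1) ^ 2) / 4) := fun j =>
    h.integral_coulomb hg hD (Ioo_subset_Icc_self (hω.2 j).1) (hω.2 j).2
  rw [energy, hpair, Finset.sum_congr rfl fun j _ => hbg j, reducedEnergy]
  -- The background gives a parabola centred at the midpoint of the tube. The constant force on
  -- particle `j`, from the difference of the numbers of particles on its two sides, moves the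
  -- minimum to site `j`.
  have key : -(lam / 2) * ∑ j : Fin N, (2 * (j : ℝ) + 1 - N) * (ω j).1 -
      ∑ j : Fin N, -((((ω j).1 - a) ^ 2 + (a + lam * N - (ω j).1) ^ 2) / 4) =
      ∑ j : Fin N, ((a ^ 2 + (a + lam * N) ^ 2) / 4 -
        (a + lam * ((j : ℝ) + 1 / 2)) ^ 2 / 2) +
      1 / 2 * ∑ j : Fin N, displacement a lam ω (j + 1) ^ 2 := by
    rw [Finset.mul_sum, Finset.mul_sum, ← Finset.sum_sub_distrib, ← Finset.sum_add_distrib]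
    refine Finset.sum_congr rfl fun j _ => ?_
    rw [displacement_succ]
    ring
  linarith

end CrossSection

/-! ### From displacements to the particle excess -/

open Classical in
theorem fst_le_iff_lt_card {Y : Type*} {a b : ℝ} {N : ℕ} {ω : Fin N → ℝ × Y}
    (hω : ω ∈ orderedConfigs Y a b N) (u : ℝ) (j : Fin N) :
    (ω j).1 ≤ u ↔ (j : ℕ) < (Finset.univ.filter fun j => (ω j).1 ≤ u).card := by
  have hmono := hω.1.monotone
  constructor
  · intro hj
    have hsub : Finset.Iic j ⊆ Finset.univ.filter fun j => (ω j).1 ≤ u := fun i hi =>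
      Finset.mem_filter.2 ⟨Finset.mem_univ _, (hmono (Finset.mem_Iic.1 hi)).trans hj⟩
    have := Finset.card_le_card hsub
    rw [Fin.card_Iic] at this
    omega
  · intro hj
    by_contra hcon
    have hsub : (Finset.univ.filter fun j => (ω j).1 ≤ u) ⊆ Finset.Iio j := fun i hi => by
      rw [Finset.mem_Iio]
      by_contra h
      exact hcon ((hmono (not_lt.1 h)).trans (Finset.mem_filter.1 hi).2)
    have := Finset.card_le_card hsub
    rw [Fin.card_Iio] at this
    omega

namespace CrossSection

variable {k : ℕ} {D : CrossSection k} {ι : Type} {E : ι → ℝ} {φ : ι → Space k → ℝ} {g : ℝ → ℝ}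

/-- A large particle excess forces a large displacement of one of two particles. -/
theorem le_abs_displacement_of_le_abs_excess (hD : 0 < D.width) {a : ℝ} {N : ℕ} {u : ℝ}
    (hu : u ∈ Icc a (a + D.spacing * N)) {γ : ℝ} (hγ : 2 ≤ γ) {ω : Fin N → ℝ × Space k}
    (hω : ω ∈ orderedConfigs (Space k) a (a + D.spacing * N) N)
    (h : γ ≤ |D.excess a (a + D.spacing * N) u ω|) :
    D.spacing * γ / 4 ≤ |displacement a D.spacing ω ⌈(u - a) / D.spacing - γ / 2⌉₊| ∨
      D.spacing * γ / 4 ≤ |displacement a D.spacing ω ⌈(u - a) / D.spacing + γ / 2⌉₊| := by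
  classical
  have hlam : 0 < D.spacing := one_div_pos.2 hD
  have hiff := fst_le_iff_lt_card hω u
  have hexc : D.excess a (a + D.spacing * N) u ω = (u - a) / D.spacing -
      ((Finset.univ.filter fun j => (ω j).1 ≤ u).card : ℝ) := by
    rw [excess, if_pos hu]
  rw [hexc] at h
  set n := (Finset.univ.filter fun j => (ω j).1 ≤ u).card
  set lam := D.spacing
  set m := (u - a) / lam with hm
  have hua : u = a + lam * m := by rw [hm]; field_simp; ring
  have hm0 : 0 ≤ m := div_nonneg (by linarith [hu.1]) hlam.le
  have hmN : m ≤ N := (div_le_iff₀ hlam).2 (by linarith [hu.2])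
  have hnN : n ≤ N := (Finset.card_le_univ _).trans (by simp)
  -- The candidate labels depend on `u` and `γ` only, so no union over labels is needed. Halving `γ`
  -- leaves the chosen particle on the wrong side of `u`, with displacement at least `λ(γ - 1)/2` in
  -- absolute value; `γ ≥ 2` turns this into `λγ/4`.
  rcases le_abs.1 h with h | h
  · left
    have h1 : 0 < m - γ / 2 := by
      have : (0 : ℝ) ≤ n := Nat.cast_nonneg n
      linarith
    have hc1 := Nat.le_ceil (m - γ / 2)
    have hc2 := Nat.ceil_lt_add_one h1.le
    have hpos : 0 < ⌈m - γ / 2⌉₊ := Nat.ceil_pos.2 h1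
    have hN : ⌈m - γ / 2⌉₊ ≤ N := Nat.ceil_le.2 (by linarith)
    obtain ⟨j, hj⟩ : ∃ j : Fin N, (j : ℕ) + 1 = ⌈m - γ / 2⌉₊ :=
      ⟨⟨⌈m - γ / 2⌉₊ - 1, by omega⟩, by simp only; omega⟩
    rw [← hj] at hc1 hc2 ⊢
    push_cast at hc1 hc2
    have hnj : n ≤ (j : ℕ) := by
      have : (n : ℝ) < (j : ℝ) + 1 := by linarith
      have : n < (j : ℕ) + 1 := by exact_mod_cast this
      omega
    have hx : u < (ω j).1 := not_le.1 fun hle => absurd ((hiff j).1 hle) (by omega)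
    refine le_trans ?_ (le_abs_self _)
    rw [displacement_succ]
    nlinarith
  · right
    have hn : m + γ ≤ n := by linarith
    have h1 : 0 < m + γ / 2 := by linarith
    have hc1 := Nat.le_ceil (m + γ / 2)
    have hc2 := Nat.ceil_lt_add_one h1.le
    have hpos : 0 < ⌈m + γ / 2⌉₊ := Nat.ceil_pos.2 h1
    have hle : ⌈m + γ / 2⌉₊ ≤ n := by
      have : (⌈m + γ / 2⌉₊ : ℝ) ≤ n := by linarith
      exact_mod_cast this
    obtain ⟨j, hj⟩ : ∃ j : Fin N, (j : ℕ) + 1 = ⌈m + γ / 2⌉₊ :=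
      ⟨⟨⌈m + γ / 2⌉₊ - 1, by omega⟩, by simp only; omega⟩
    rw [← hj] at hc1 hc2 ⊢
    push_cast at hc1 hc2
    have hx : (ω j).1 ≤ u := (hiff j).2 (by omega)
    refine le_trans ?_ (neg_le_abs _)
    rw [displacement_succ]
    nlinarith

theorem configSpace_eq (a b : ℝ) (N : ℕ) :
    D.configSpace a b N =
      orderedConfigs (Space k) a b N ∩ univ.pi fun _ => univ ×ˢ D.carrier := by
  ext ω
  simp only [configSpace, orderedConfigs, mem_inter_iff, mem_ofPred_eq, mem_univ_pi, mem_prod,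
    mem_univ, true_and]
  exact ⟨fun h => ⟨⟨h.1, fun j => (h.2 j).1⟩, fun j => (h.2 j).2⟩,
    fun h => ⟨h.1.1, fun j => ⟨h.1.2 j, h.2 j⟩⟩⟩

/-- The constant `c` comes from the additive constant of the energy and cancels in the normalized
measure. -/
theorem IsAdmissible.exists_gibbsWeight_apply [Countable ι] (h : D.IsAdmissible E φ g)
    (hg : IsDecayProfile g) (hD : 0 < D.width) (β a : ℝ) (N : ℕ) :
    ∃ c : ℝ≥0∞, c ≠ 0 ∧ c ≠ ∞ ∧ ∀ s, MeasurableSet s →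
      D.gibbsWeight E φ β a (a + D.spacing * N) N s =
        c * ∫⁻ ω, s.indicator (boltzmann β a D.spacing (D.shortRangeExt E φ) N) ω
          ∂(Measure.pi fun _ => (volume : Measure ℝ).prod (volume.restrict D.carrier)) := by
  obtain ⟨c, hc⟩ := h.exists_energy_eq hg hD a N
  refine ⟨ENNReal.ofReal (Real.exp (-(β * c))), by positivity, ENNReal.ofReal_ne_top,
    fun s hs => ?_⟩
  set b := a + D.spacing * N
  have hbm := measurable_boltzmann β a D.spacing h.measurable_shortRangeExt N
  have hO : MeasurableSet (orderedConfigs (Space k) a b N) := measurableSet_orderedConfigs b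
  have hT : MeasurableSet (univ.pi fun _ : Fin N => (univ : Set ℝ) ×ˢ D.carrier) :=
    MeasurableSet.univ_pi fun _ => MeasurableSet.univ.prod D.measurableSet_carrier
  have hcs : MeasurableSet (D.configSpace a b N) := by
    rw [configSpace_eq]; exact hO.inter hT
  have hpi : (volume : Measure (Fin N → ℝ × Space k)).restrict
      (univ.pi fun _ => univ ×ˢ D.carrier) =
      Measure.pi fun _ => (volume : Measure ℝ).prod (volume.restrict D.carrier) := by
    rw [volume_pi, Measure.restrict_pi_pi]
    congr 1
    funext i
    rw [Measure.volume_eq_prod, ← Measure.prod_restrict, Measure.restrict_univ]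
  rw [gibbsWeight, withDensity_apply _ hs, Measure.restrict_restrict hs,
    ← lintegral_const_mul _ (hbm.indicator hs)]
  calc ∫⁻ ω in s ∩ D.configSpace a b N, ENNReal.ofReal (Real.exp (-(β * D.energy E φ a b ω)))
      = ∫⁻ ω in s ∩ D.configSpace a b N, ENNReal.ofReal (Real.exp (-(β * c))) *
          s.indicator (boltzmann β a D.spacing (D.shortRangeExt E φ) N) ω := by
        refine setLIntegral_congr_fun (hs.inter hcs) fun ω hω => ?_
        have hωO : ω ∈ orderedConfigs (Space k) a b N := by
          have := hω.2
          rw [configSpace_eq] at this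
          exact this.1
        rw [indicator_of_mem hω.1, boltzmann, indicator_of_mem hωO, hc ω hω.2,
          ← ENNReal.ofReal_mul (by positivity), ← Real.exp_add]
        congr 2
        ring
    _ = ∫⁻ ω in univ.pi fun _ => univ ×ˢ D.carrier,
          (s ∩ orderedConfigs (Space k) a b N).indicator
            (fun ω => ENNReal.ofReal (Real.exp (-(β * c))) *
              s.indicator (boltzmann β a D.spacing (D.shortRangeExt E φ) N) ω) ω := by
        rw [lintegral_indicator (hs.inter hO), Measure.restrict_restrict (hs.inter hO),
          configSpace_eq, inter_assoc]
    _ = _ := by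
        rw [hpi]
        refine lintegral_congr fun ω => ?_
        by_cases h1 : ω ∈ s
        · by_cases h2 : ω ∈ orderedConfigs (Space k) a b N
          · rw [indicator_of_mem (show ω ∈ s ∩ orderedConfigs (Space k) a b N from ⟨h1, h2⟩)]
          · rw [indicator_of_notMem fun h => h2 h.2, indicator_of_mem h1, boltzmann,
              indicator_of_notMem h2, mul_zero]
        · rw [indicator_of_notMem fun h => h1 h.1, indicator_of_notMem h1, mul_zero]

end CrossSection

/-- Gaussian tails of the particle excess, with constants that depend on the profile only. -/
theorem exists_excess_tail {β W : ℝ} (hβ : 0 < β) (hW : 0 < W) {g : ℝ → ℝ}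
    (hg : IsDecayProfile g) :
    ∃ C A : ℝ, 0 < A ∧
      ∀ (k : ℕ) (D : CrossSection k), D.width = W →
      ∀ (ι : Type) [Countable ι] (E : ι → ℝ) (φ : ι → Space k → ℝ), D.IsAdmissible E φ g →
      ∀ (a : ℝ) (N : ℕ), IsProbabilityMeasure (D.gibbs E φ β a (a + D.spacing * N) N) ∧
        ∀ x ∈ Icc a (a + D.spacing * N), ∀ γ : ℝ, 0 ≤ γ →
          D.gibbs E φ β a (a + D.spacing * N) N
              {ω | γ ≤ |D.excess a (a + D.spacing * N) x ω|} ≤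
            ENNReal.ofReal (C * Real.exp (-(A * γ ^ 2))) := by
  have hlam : 0 < 1 / W := one_div_pos.2 hW
  obtain ⟨C, A, hA, hC, htail⟩ := exists_displacement_tail hβ hlam hg
  refine ⟨2 * C * Real.exp (A * (1 / W / 4) ^ 2 * 4), A * (1 / W / 4) ^ 2, by positivity, ?_⟩
  rintro k D rfl ι _ E φ h a N
  change 0 < D.spacing at hlam
  change ∀ {Y : Type} [MeasurableSpace Y] {μ : Measure Y} [IsFiniteMeasure μ]
      {v : Y → Y → ℝ → ℝ}, IsPairPotential μ v g → μ.real univ * D.spacing = 1 →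
      ∀ (a : ℝ) {N u₀ : ℕ}, 1 ≤ u₀ → u₀ ≤ N → ∀ γ : ℝ, 0 ≤ γ →
      ∫⁻ ω, {ω | γ ≤ |displacement a D.spacing ω u₀|}.indicator
          (boltzmann β a D.spacing v N) ω
          ∂(Measure.pi fun _ => (volume : Measure ℝ).prod μ) ≤
        ENNReal.ofReal (C * Real.exp (-(A * γ ^ 2))) *
          ∫⁻ ω, boltzmann β a D.spacing v N ω
            ∂(Measure.pi fun _ => (volume : Measure ℝ).prod μ) at htail
  change _ ∧ ∀ x ∈ _, ∀ γ : ℝ, 0 ≤ γ → _ ≤ ENNReal.ofReal (2 * C *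
    Real.exp (A * (D.spacing / 4) ^ 2 * 4) * Real.exp (-(A * (D.spacing / 4) ^ 2 * γ ^ 2)))
  have hv := h.isPairPotential hg
  have hμ : ((volume : Measure (Space k)).restrict D.carrier).real univ * D.spacing = 1 := by
    rw [D.real_univ_restrict_carrier, CrossSection.spacing]
    field_simp
  set lam := D.spacing with hlamdef
  set b := a + lam * N with hb
  have hZt := lintegral_boltzmann_lt_top (a := a) hv hg hβ hlam hμ N
  have hZp := lintegral_boltzmann_pos (a := a) hv hg hβ hlam hμ N
  obtain ⟨c, hc0, hct, hw⟩ := h.exists_gibbsWeight_apply hg hW β a N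
  rw [← hlamdef, ← hb] at hw
  have hwu := hw univ MeasurableSet.univ
  rw [indicator_univ] at hwu
  set Z := ∫⁻ ω, boltzmann β a lam (D.shortRangeExt E φ) N ω
    ∂(Measure.pi fun _ => (volume : Measure ℝ).prod (volume.restrict D.carrier))
  have hw0 : D.gibbsWeight E φ β a b N univ ≠ 0 := by
    rw [hwu]; exact mul_ne_zero hc0 hZp.ne'
  have hwt : D.gibbsWeight E φ β a b N univ ≠ ∞ := by
    rw [hwu]; exact ENNReal.mul_ne_top hct hZt.ne
  have hprob : IsProbabilityMeasure (D.gibbs E φ β a b N) :=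
    ⟨by rw [CrossSection.gibbs, Measure.smul_apply, smul_eq_mul, ENNReal.inv_mul_cancel hw0 hwt]⟩
  refine ⟨hprob, fun x hx γ hγ => ?_⟩
  -- The factor `exp (A (λ/4)² * 4)` in the constant makes the bound at least `1` for `γ < 2`.
  rcases lt_or_ge γ 2 with hsmall | hlarge
  · refine prob_le_one.trans ?_
    rw [← ENNReal.ofReal_one, mul_assoc, ← Real.exp_add]
    refine ENNReal.ofReal_le_ofReal ?_
    have h1 : 1 ≤ Real.exp (A * (lam / 4) ^ 2 * 4 + -(A * (lam / 4) ^ 2 * γ ^ 2)) := by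
      refine Real.one_le_exp ?_
      have : 0 ≤ A * (lam / 4) ^ 2 := by positivity
      have h4 : γ ^ 2 ≤ 4 := by nlinarith
      nlinarith
    nlinarith
  have hgibbs : ∀ s, MeasurableSet s → ∀ r : ℝ≥0∞,
      ∫⁻ ω, s.indicator (boltzmann β a lam (D.shortRangeExt E φ) N) ω
        ∂(Measure.pi fun _ => (volume : Measure ℝ).prod (volume.restrict D.carrier)) ≤ r * Z →
      D.gibbs E φ β a b N s ≤ r := by
    intro s hs r hr
    rw [CrossSection.gibbs, Measure.smul_apply, smul_eq_mul, ENNReal.inv_mul_le_iff hw0 hwt,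
      hw s hs, hwu]
    calc _ ≤ c * (r * Z) := by gcongr
      _ = c * Z * r := by ring
  have hdisp : ∀ u : ℕ, D.gibbs E φ β a b N {ω | lam * γ / 4 ≤ |displacement a lam ω u|} ≤
      ENNReal.ofReal (C * Real.exp (-(A * (lam * γ / 4) ^ 2))) := by
    intro u
    by_cases hu : 1 ≤ u ∧ u ≤ N
    · exact hgibbs _ (measurableSet_le measurable_const (measurable_displacement u).abs) _
        (htail hv hμ a hu.1 hu.2 _ (by positivity))
    · have hpos : 0 < lam * γ / 4 := by positivity
      have : {ω : Fin N → ℝ × Space k | lam * γ / 4 ≤ |displacement a lam ω u|} = ∅ := by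
        refine eq_empty_of_forall_notMem fun ω hω => ?_
        have hz : displacement a lam ω u = 0 := by
          rcases Nat.eq_zero_or_pos u with rfl | h1
          · rfl
          · exact displacement_of_lt ω (by omega)
        rw [mem_ofPred_eq, hz, abs_zero] at hω
        linarith
      rw [this, measure_empty]
      exact zero_le
  have hout : D.gibbs E φ β a b N (orderedConfigs (Space k) a b N)ᶜ ≤ 0 := by
    refine hgibbs _ (measurableSet_orderedConfigs b).compl _ (le_of_eq ?_)
    rw [zero_mul, ← lintegral_zero]
    refine lintegral_congr fun ω => ?_
    by_cases hω : ω ∈ orderedConfigs (Space k) a b N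
    · rw [indicator_of_notMem (not_not.2 hω)]
    · rw [indicator_of_mem hω, boltzmann, indicator_of_notMem hω]
  set u₁ := ⌈(x - a) / lam - γ / 2⌉₊
  set u₂ := ⌈(x - a) / lam + γ / 2⌉₊
  calc D.gibbs E φ β a b N {ω | γ ≤ |D.excess a b x ω|}
      ≤ D.gibbs E φ β a b N ((orderedConfigs (Space k) a b N)ᶜ ∪
          ({ω | lam * γ / 4 ≤ |displacement a lam ω u₁|} ∪
            {ω | lam * γ / 4 ≤ |displacement a lam ω u₂|})) := by
        refine measure_mono fun ω hω => ?_
        by_cases hωO : ω ∈ orderedConfigs (Space k) a b N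
        · exact Or.inr (CrossSection.le_abs_displacement_of_le_abs_excess hW hx hlarge hωO hω)
        · exact Or.inl hωO
    _ ≤ 0 + (ENNReal.ofReal (C * Real.exp (-(A * (lam * γ / 4) ^ 2))) +
          ENNReal.ofReal (C * Real.exp (-(A * (lam * γ / 4) ^ 2)))) :=
        (measure_union_le _ _).trans (add_le_add hout
          ((measure_union_le _ _).trans (add_le_add (hdisp u₁) (hdisp u₂))))
    _ ≤ _ := by
        rw [zero_add, ← ENNReal.ofReal_add (by positivity) (by positivity)]
        refine ENNReal.ofReal_le_ofReal ?_
        have e : A * (lam * γ / 4) ^ 2 = A * (lam / 4) ^ 2 * γ ^ 2 := by ring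
        have h1 : 1 ≤ Real.exp (A * (lam / 4) ^ 2 * 4) := Real.one_le_exp (by positivity)
        rw [e, ← two_mul, ← mul_assoc]
        exact mul_le_mul_of_nonneg_right (le_mul_of_one_le_right (by positivity) h1)
          (Real.exp_pos _).le

end Jellium

end

theorem theorem2 (β W : ℝ) (hβ : 0 < β) (hW : 0 < W) (g : ℝ → ℝ)
    (hg : Jellium.IsDecayProfile g) :
    ∃ C A : ℝ, 0 < A ∧
      ∀ (k : ℕ) (D : Jellium.CrossSection k), D.width = W →
      ∀ (ι : Type) [Countable ι] (E : ι → ℝ) (φ : ι → Jellium.Space k → ℝ),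
        D.IsAdmissible E φ g →
      ∀ (n₁ n₂ : ℤ) (θ : ℝ), θ ∈ Set.Ico (0 : ℝ) 1 →
      ∀ x ∈ Set.Icc (D.leftEnd n₁ θ) (D.rightEnd n₂ θ),
        MeasureTheory.IsProbabilityMeasure (D.thetaGibbs E φ β θ n₁ n₂) ∧
        ∀ γ : ℝ, 0 ≤ γ →
          D.thetaGibbs E φ β θ n₁ n₂
              {ω | γ ≤ |D.excess (D.leftEnd n₁ θ) (D.rightEnd n₂ θ) x ω|} ≤
            ENNReal.ofReal (C * Real.exp (-(A * γ ^ 2))) := by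
  obtain ⟨C, A, hA, hmain⟩ := Jellium.exists_excess_tail hβ hW hg
  refine ⟨C, A, hA, fun k D hD ι _ E φ h n₁ n₂ θ _ x hx => ?_⟩
  have hlam : 0 < D.spacing := by
    rw [Jellium.CrossSection.spacing, hD]
    exact one_div_pos.2 hW
  have hle := hx.1.trans hx.2
  rw [Jellium.CrossSection.leftEnd, Jellium.CrossSection.rightEnd] at hle
  -- The interval contains `x`, so its length `(n₁ + n₂)λ` is nonnegative and `toNat` loses nothing.
  have hn : (0 : ℝ) ≤ (n₁ + n₂ : ℤ) := by
    have := le_of_mul_le_mul_right hle hlam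
    push_cast
    linarith
  have hn' : (0 : ℤ) ≤ n₁ + n₂ := by exact_mod_cast hn
  have hcast : (((n₁ + n₂).toNat : ℕ) : ℝ) = n₁ + n₂ := by
    have : (((n₁ + n₂).toNat : ℤ) : ℝ) = ((n₁ + n₂ : ℤ) : ℝ) := by rw [Int.toNat_of_nonneg hn']
    push_cast at this
    exact this
  have hend : D.rightEnd n₂ θ = D.leftEnd n₁ θ + D.spacing * (n₁ + n₂).toNat := by
    rw [hcast, Jellium.CrossSection.leftEnd, Jellium.CrossSection.rightEnd]
    ring
  obtain ⟨hprob, htail⟩ := hmain k D hD ι E φ h (D.leftEnd n₁ θ) (n₁ + n₂).toNat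
  rw [← hend] at hprob htail
  exact ⟨hprob, htail x hx⟩
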